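/- **Setting.** Let $\mathcal H_1$ be the universal enveloping algebra of the complex Lie algebra with basis $X,Y,\delta_1,\delta_2,\dots$ and brackets $[Y,X]=X$, $[X,\delta_n]=\delta_{n+1}$, $[Y,\delta_n]=n\delta_n$, $[\delta_n,\delta_m]=0$, with the coproduct determined by $\Delta Y=Y\otimes1+1\otimes Y$, $\Delta\delta_1=\delta_1\otimes1+1\otimes\delta_1$, $\Delta X=X\otimes1+1\otimes X+\delta_1\otimes Y$, $\Delta\delta_{n+1}=[\Delta X,\Delta\delta_n]$. Let $P=\mathbb C[Z_0,Z_1,\dots]$, on which $X,Y,\delta_n$ act as the derivations $X(Z_j)=Z_{j+1}$, $Y(Z_j)=(j+2)Z_j$, $\delta_n=0$. Let $\tilde{\mathcal H}_1=P\rtimes\mathcal H_1\ltimes P$ be the double crossed product: it is generated by $\mathcal H_1$ and two commuting copies $\alpha(P),\beta(P)$ of $P$ subject to $h\,\alpha(p)=\sum\alpha(h_{(1)}p)h_{(2)}$ and $h\,\beta(q)=\sum\beta(h_{(2)}q)h_{(1)}$, and $p\rtimes h\ltimes q=\alpha(p)\beta(q)h$. Let $\tilde{\mathcal H}_s$ be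 the quotient of $\tilde{\mathcal H}_1$ by the two-sided ideal generated by $\delta_2-\tfrac12\delta_1^2-\alpha(Z_0)+\beta(Z_0)$. The tensor product $\tilde{\mathcal H}_s\otimes_P\cdots\otimes_P\tilde{\mathcal H}_s$ is the tensor product over $\mathbb C$ modulo the relations $\cdots\otimes\beta(p)h\otimes h'\otimes\cdots=\cdots\otimes h\otimes\alpha(p)h'\otimes\cdots$, $p\in P$. Let $\nu:\mathbb R\to\mathbb R$ be smooth and put $\mu(x_1,x_2)=x_2\nu(x_1)$. Let $\nabla$ be the connection on $\{(x_1,x_2):x_2>0\}$ with $\nabla_{\partial_1}\partial_1=\mu\,\partial_2$, $\nabla_{\partial_1}\partial_2=\nabla_{\partial_2}\partial_1=\frac1{2x_2}\partial_1$, $\nabla_{\partial_2}\partial_2=-\frac1{2x_2}\partial_2$. A pseudogroup $\Gamma$ of orientation-preserving smooth local diffeomorphisms of $\mathbb R$ is *compatible* with $\nu$ if for every $\phi\in\Gamma$ the lift $(x_1,x_2)\mapsto(\phi(x_1),x_2/\phi'(x_1))$ preserves $\nabla$. Let $\mathcal A_{x_2\nu(x_1),\Gamma}=C_c^\infty(\mathbb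 R\times\mathbb R^+)\rtimes\Gamma$ be the smooth complex convolution algebra of the groupoid of germs of $\Gamma$ acting on $\mathbb R\times\mathbb R^+$ by the lifts $\tilde\phi(x,y)=(\phi(x),\phi'(x)y)$ (so $y=1/x_2$). It is spanned by the monomials $fU_{\phi^{-1}}$ with $\phi\in\Gamma$ and $f$ smooth with compact support in $\operatorname{dom}\phi\times\mathbb R^+$; these are linear in $f$ and depend on $\phi$ only through its germs along the support of $f$, and $fU_{\phi^{-1}}\cdot gU_{\psi^{-1}}=f\,(g\circ\tilde\phi)\,U_{(\psi\circ\phi)^{-1}}$. Let $\mathcal H_1$ act on it by $$X(fU_{\phi^{-1}})=y\,\partial_xf\,U_{\phi^{-1}},\quad Y(fU_{\phi^{-1}})=y\,\partial_yf\,U_{\phi^{-1}},\quad \delta_n(fU_{\phi^{-1}})=(y\partial_x)^{n-1}\!\Big(y\frac{\phi''(x)}{\phi'(x)}\Big)f\,U_{\phi^{-1}}.$$ Put $\Omega(x,y)=-y^2\nu(x)$, let $\rho$ be the algebra homomorphism from $P$ to the smooth functions on $\mathbb R\times\mathbb R^+$ with $\rho(Z_k)=(y\partial_x)^k\Omega$,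 and let such functions act on the algebra by $F\cdot fU_{\phi^{-1}}=Ff\,U_{\phi^{-1}}$ and $fU_{\phi^{-1}}\cdot F=f\,(F\circ\tilde\phi)\,U_{\phi^{-1}}$. Then $\chi(p\rtimes h\ltimes q)(a)=\rho(p)\,h(a)\,\rho(q)$ defines an action of $\tilde{\mathcal H}_s$ on $\mathcal A_{x_2\nu(x_1),\Gamma}$, and for $n\ge1$ $$\chi^{(n)}_{x_2\nu(x_1),\Gamma}(h_1\otimes\cdots\otimes h_n)(a_1\otimes\cdots\otimes a_n)=\chi(h_1)(a_1)\cdots\chi(h_n)(a_n)$$ defines a linear map from the $n$-fold tensor product $\tilde{\mathcal H}_s\otimes_P\cdots\otimes_P\tilde{\mathcal H}_s$ to $\mathcal L(\mathcal A_{x_2\nu(x_1),\Gamma}^{\otimes n},\mathcal A_{x_2\nu(x_1),\Gamma})$. **Proposition.** For each integer $n\ge1$, $$\bigcap_{\nu,\Gamma}\operatorname{Ker}\chi^{(n)}_{x_2\nu(x_1),\Gamma}=0,$$ where $\nu$ runs over all smooth functions $\mathbb R\to\mathbb R$ and $\Gamma$ over all pseudogroups compatible with $\nu$. In other words, this family of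 actions is fully injective. -/

import Mathlib

open scoped ContDiff Topology TensorProduct

noncomputable section

namespace FoliationHopf

/-- The coefficient algebra `P`: polynomials in `Z 0, Z 1, Z 2, ...`. -/
abbrev P : Type := MvPolynomial ℕ ℂ

/-- The action of `X` on `P`: the derivation with `X (Z j) = Z (j + 1)`. -/
def dX : Derivation ℂ P P := MvPolynomial.mkDerivation ℂ fun j => MvPolynomial.X (j + 1)

/-- The action of `Y` on `P`: the derivation with `Y (Z j) = (j + 2) Z j`. -/
def dY : Derivation ℂ P P :=
  MvPolynomial.mkDerivation ℂ fun j => ((j : ℂ) + 2) • (MvPolynomial.X j : P)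

/-- Generators of the double crossed product: `X`, `Y`, `delta n` (which stands for `δ_{n+1}`),
and the two copies `alpha p`, `beta p` of `P`. -/
inductive Gen : Type
  | X : Gen
  | Y : Gen
  | delta (n : ℕ) : Gen
  | alpha (p : P) : Gen
  | beta (p : P) : Gen

namespace Gen

/-- A generator as an element of the free algebra. -/
abbrev of (g : Gen) : FreeAlgebra ℂ Gen := FreeAlgebra.ι ℂ g

end Gen

open Gen in
/-- The defining relations of the double crossed product `P ⋊ H₁ ⋉ P`.

The first four are the brackets of the Lie algebra with basis `X, Y, δ_1, δ_2, ...`, so that the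
subalgebra of words in `X`, `Y`, `delta n` is a copy of its enveloping algebra `H₁`.
The next seven say that `alpha` and `beta` are algebra homomorphisms with commuting images.
The last six are the crossed product rules
`h α(p) = ∑ α(h₍₁₎ p) h₍₂₎` and `h β(q) = ∑ β(h₍₂₎ q) h₍₁₎` for the Lie generators `h`, with
`Δ X = X ⊗ 1 + 1 ⊗ X + δ_1 ⊗ Y`, `Δ Y = Y ⊗ 1 + 1 ⊗ Y`; in `Δ δ_n - δ_n ⊗ 1 - 1 ⊗ δ_n` both
tensor factors are polynomials in the `δ`'s without constant term, and these act on `P` by `0`. -/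
inductive Rel1 : FreeAlgebra ℂ Gen → FreeAlgebra ℂ Gen → Prop
  | Y_X : Rel1 (of Y * of X) (of X * of Y + of X)
  | X_delta (n : ℕ) : Rel1 (of X * of (delta n)) (of (delta n) * of X + of (delta (n + 1)))
  | Y_delta (n : ℕ) :
      Rel1 (of Y * of (delta n)) (of (delta n) * of Y + ((n : ℂ) + 1) • of (delta n))
  | delta_delta (n m : ℕ) : Rel1 (of (delta n) * of (delta m)) (of (delta m) * of (delta n))
  | alpha_const (c : ℂ) : Rel1 (of (alpha (MvPolynomial.C c))) (algebraMap ℂ _ c)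
  | alpha_add (p q : P) : Rel1 (of (alpha (p + q))) (of (alpha p) + of (alpha q))
  | alpha_mul (p q : P) : Rel1 (of (alpha (p * q))) (of (alpha p) * of (alpha q))
  | beta_const (c : ℂ) : Rel1 (of (beta (MvPolynomial.C c))) (algebraMap ℂ _ c)
  | beta_add (p q : P) : Rel1 (of (beta (p + q))) (of (beta p) + of (beta q))
  | beta_mul (p q : P) : Rel1 (of (beta (p * q))) (of (beta p) * of (beta q))
  | alpha_beta (p q : P) : Rel1 (of (alpha p) * of (beta q)) (of (beta q) * of (alpha p))
  | X_alpha (p : P) : Rel1 (of X * of (alpha p)) (of (alpha p) * of X + of (alpha (dX p)))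
  | Y_alpha (p : P) : Rel1 (of Y * of (alpha p)) (of (alpha p) * of Y + of (alpha (dY p)))
  | delta_alpha (n : ℕ) (p : P) :
      Rel1 (of (delta n) * of (alpha p)) (of (alpha p) * of (delta n))
  | X_beta (q : P) :
      Rel1 (of X * of (beta q))
        (of (beta q) * of X + of (beta (dX q)) + of (beta (dY q)) * of (delta 0))
  | Y_beta (q : P) : Rel1 (of Y * of (beta q)) (of (beta q) * of Y + of (beta (dY q)))
  | delta_beta (n : ℕ) (q : P) :
      Rel1 (of (delta n) * of (beta q)) (of (beta q) * of (delta n))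

/-- The double crossed product `P ⋊ H₁ ⋉ P`; the element `p ⋊ h ⋉ q` is `α(p) β(q) h`. -/
def H1tilde : Type := RingQuot Rel1

instance : Ring H1tilde := inferInstanceAs (Ring (RingQuot Rel1))

instance : Algebra ℂ H1tilde := inferInstanceAs (Algebra ℂ (RingQuot Rel1))

/-- The class of a generator. -/
def H1tilde.gen (g : Gen) : H1tilde := RingQuot.mkAlgHom ℂ Rel1 (FreeAlgebra.ι ℂ g)

open H1tilde in
/-- The relation `δ_2 - (1/2) δ_1 ^ 2 - α(Z 0) + β(Z 0) = 0`
(recall that `delta 0`, `delta 1` stand for `δ_1`, `δ_2`). -/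
inductive RelS : H1tilde → H1tilde → Prop
  | delta2 :
      RelS (gen (.delta 1) - (1 / 2 : ℂ) • gen (.delta 0) ^ 2
        - gen (.alpha (MvPolynomial.X 0)) + gen (.beta (MvPolynomial.X 0))) 0

/-- The quotient of `P ⋊ H₁ ⋉ P` by the two-sided ideal generated by
`δ_2 - (1/2) δ_1 ^ 2 - α(Z 0) + β(Z 0)`. -/
def Hs : Type := RingQuot RelS

instance : Ring Hs := inferInstanceAs (Ring (RingQuot RelS))

instance : Algebra ℂ Hs := inferInstanceAs (Algebra ℂ (RingQuot RelS))

/-- The class of a generator in the quotient. -/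
def Hs.gen (g : Gen) : Hs := RingQuot.mkAlgHom ℂ RelS (H1tilde.gen g)

/-- The relations that pass from the `(n + 1)`-fold tensor power of `Hs` over `ℂ` to the one over
`P`: `⋯ ⊗ β(p) hᵢ ⊗ hᵢ₊₁ ⊗ ⋯ = ⋯ ⊗ hᵢ ⊗ α(p) hᵢ₊₁ ⊗ ⋯`. -/
def balanced (n : ℕ) : Submodule ℂ (⨂[ℂ] _ : Fin (n + 1), Hs) :=
  Submodule.span ℂ {t | ∃ (h : Fin (n + 1) → Hs) (i : Fin n) (p : P),
    t = PiTensorProduct.tprod ℂ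
          (Function.update h i.castSucc (Hs.gen (.beta p) * h i.castSucc))
      - PiTensorProduct.tprod ℂ
          (Function.update h i.succ (Hs.gen (.alpha p) * h i.succ))}

/-- The tensor product `Hs ⊗_P ⋯ ⊗_P Hs` with `n + 1` factors. -/
abbrev HsTensor (n : ℕ) : Type := (⨂[ℂ] _ : Fin (n + 1), Hs) ⧸ balanced n

/-! ### Invariant connections and pseudogroups -/

/-- The covariant derivative `∇_U V` on `{(x₁, x₂) | x₂ > 0}` of the connection with
`∇₁∂₁ = μ ∂₂`, `∇₁∂₂ = ∇₂∂₁ = (1 / (2 x₂)) ∂₁`, `∇₂∂₂ = -(1 / (2 x₂)) ∂₂`. -/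
def nabla (μ : ℝ × ℝ → ℝ) (U V : ℝ × ℝ → ℝ × ℝ) (z : ℝ × ℝ) : ℝ × ℝ :=
  fderiv ℝ V z (U z) +
    (((U z).1 * (V z).2 + (U z).2 * (V z).1) / (2 * z.2),
      μ z * ((U z).1 * (V z).1) - (U z).2 * (V z).2 / (2 * z.2))

/-- The part `dom φ × (0, ∞)` of the half-plane on which the lifts of `φ` are defined. -/
def slab (φ : OpenPartialHomeomorph ℝ ℝ) : Set (ℝ × ℝ) := {z | z.1 ∈ φ.source ∧ 0 < z.2}

/-- The lift of `φ` to the positive half of the cotangent bundle,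
`(x₁, x₂) ↦ (φ x₁, x₂ / φ'(x₁))`. -/
def cotLift (φ : ℝ → ℝ) (z : ℝ × ℝ) : ℝ × ℝ := (φ z.1, z.2 / deriv φ z.1)

/-- The push-forward of a vector field along the lift of `φ`. -/
def pushforward (φ : OpenPartialHomeomorph ℝ ℝ) (V : ℝ × ℝ → ℝ × ℝ) (w : ℝ × ℝ) : ℝ × ℝ :=
  fderiv ℝ (cotLift φ) (cotLift φ.symm w) (V (cotLift φ.symm w))

/-- The lift of `φ` preserves the connection: `Φ_* (∇_U V) = ∇_{Φ_* U} (Φ_* V)` for all smooth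
vector fields `U`, `V` on its domain. -/
def Preserves (μ : ℝ × ℝ → ℝ) (φ : OpenPartialHomeomorph ℝ ℝ) : Prop :=
  ∀ U V : ℝ × ℝ → ℝ × ℝ, ContDiffOn ℝ ∞ U (slab φ) → ContDiffOn ℝ ∞ V (slab φ) →
    ∀ w ∈ slab φ.symm,
      nabla μ (pushforward φ U) (pushforward φ V) w = pushforward φ (nabla μ U V) w

/-- `Γ` is a pseudogroup of orientation preserving smooth local diffeomorphisms of `ℝ` whose
lifts preserve the connection with `μ = x₂ ν(x₁)`. -/
structure IsCompatible (ν : ℝ → ℝ) (Γ : StructureGroupoid ℝ) : Prop where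
  restr : ClosedUnderRestriction Γ
  smooth : ∀ φ ∈ Γ, ContDiffOn ℝ ∞ φ φ.source
  deriv_pos : ∀ φ ∈ Γ, ∀ x ∈ φ.source, 0 < deriv φ x
  preserves : ∀ φ ∈ Γ, Preserves (fun z => z.2 * ν z.1) φ

/-- A smooth function `ν` together with a compatible pseudogroup. -/
structure Datum where
  ν : ℝ → ℝ
  smooth : ContDiff ℝ ∞ ν
  Γ : StructureGroupoid ℝ
  compat : IsCompatible ν Γ

/-! ### Functions on the frame bundle `{(x, y) | y > 0}` of `ℝ` -/

/-- The vector field `X = y ∂_x`. -/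
def opX (F : ℝ × ℝ → ℂ) (z : ℝ × ℝ) : ℂ := z.2 • fderiv ℝ F z (1, 0)

/-- The vector field `Y = y ∂_y`. -/
def opY (F : ℝ × ℝ → ℂ) (z : ℝ × ℝ) : ℂ := z.2 • fderiv ℝ F z (0, 1)

/-- The lift of `φ` to the frame bundle, `(x, y) ↦ (φ x, φ'(x) y)`; it corresponds to `cotLift`
under `y = 1 / x₂`. -/
def frameLift (φ : ℝ → ℝ) (z : ℝ × ℝ) : ℝ × ℝ := (φ z.1, deriv φ z.1 * z.2)

/-- The function `y φ''(x) / φ'(x)`. -/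
def muFn (φ : ℝ → ℝ) (z : ℝ × ℝ) : ℂ := ((z.2 * (deriv (deriv φ) z.1 / deriv φ z.1) : ℝ) : ℂ)

/-- The function `X ^ n (y φ'' / φ')`, by which `δ_{n+1}` acts. -/
def deltaFn (φ : ℝ → ℝ) (n : ℕ) : ℝ × ℝ → ℂ := opX^[n] (muFn φ)

/-- The function `Ω = -y² ν(x)`. With this sign `δ_2 - (1/2) δ_1 ^ 2` acts as the commutator
with `Ω` on the groupoid algebra of every pseudogroup compatible with `ν`. -/
def Omega (ν : ℝ → ℝ) (z : ℝ × ℝ) : ℂ := ((-(z.2 ^ 2 * ν z.1) : ℝ) : ℂ)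

/-- The homomorphism from `P` to functions with `Z k ↦ X ^ k Ω`. -/
def rho (ν : ℝ → ℝ) : P →ₐ[ℂ] (ℝ × ℝ → ℂ) := MvPolynomial.aeval fun k => opX^[k] (Omega ν)

/-! ### Calculus facts -/

theorem isOpen_slab (φ : OpenPartialHomeomorph ℝ ℝ) : IsOpen (slab φ) :=
  (φ.open_source.preimage continuous_fst).inter (isOpen_lt continuous_const continuous_snd)

theorem contDiff_mul_of_tsupport {f G : ℝ × ℝ → ℂ} {U : Set (ℝ × ℝ)} (hU : IsOpen U)
    (hf : ContDiff ℝ ∞ f) (hs : tsupport f ⊆ U) (hG : ContDiffOn ℝ ∞ G U) :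
    ContDiff ℝ ∞ fun z => f z * G z := by
  rw [contDiff_iff_contDiffAt]
  intro z
  by_cases hz : z ∈ U
  · exact hf.contDiffAt.mul (hG.contDiffAt (hU.mem_nhds hz))
  · have h0 : f =ᶠ[𝓝 z] 0 := notMem_tsupport_iff_eventuallyEq.mp fun h => hz (hs h)
    refine (contDiffAt_const (c := (0 : ℂ))).congr_of_eventuallyEq ?_
    filter_upwards [h0] with w hw
    simp [hw]

theorem contDiffOn_opX {F : ℝ × ℝ → ℂ} {U : Set (ℝ × ℝ)} (hU : IsOpen U)
    (hF : ContDiffOn ℝ ∞ F U) : ContDiffOn ℝ ∞ (opX F) U :=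
  contDiff_snd.contDiffOn.smul
    ((hF.fderiv_of_isOpen hU (m := ∞) (by simp)).clm_apply contDiffOn_const)

theorem contDiffOn_opY {F : ℝ × ℝ → ℂ} {U : Set (ℝ × ℝ)} (hU : IsOpen U)
    (hF : ContDiffOn ℝ ∞ F U) : ContDiffOn ℝ ∞ (opY F) U :=
  contDiff_snd.contDiffOn.smul
    ((hF.fderiv_of_isOpen hU (m := ∞) (by simp)).clm_apply contDiffOn_const)

theorem contDiffOn_opX_iterate {F : ℝ × ℝ → ℂ} {U : Set (ℝ × ℝ)} (hU : IsOpen U)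
    (hF : ContDiffOn ℝ ∞ F U) (n : ℕ) : ContDiffOn ℝ ∞ (opX^[n] F) U := by
  induction n with
  | zero => exact hF
  | succ n ih => rw [Function.iterate_succ_apply']; exact contDiffOn_opX hU ih

theorem opX_congr {F G : ℝ × ℝ → ℂ} {z : ℝ × ℝ} (h : F =ᶠ[𝓝 z] G) : opX F z = opX G z := by
  simp only [opX, h.fderiv_eq]

theorem opY_congr {F G : ℝ × ℝ → ℂ} {z : ℝ × ℝ} (h : F =ᶠ[𝓝 z] G) : opY F z = opY G z := by
  simp only [opY, h.fderiv_eq]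

theorem opX_mul {F G : ℝ × ℝ → ℂ} {z : ℝ × ℝ} (hF : DifferentiableAt ℝ F z)
    (hG : DifferentiableAt ℝ G z) :
    opX (fun w => F w * G w) z = opX F z * G z + F z * opX G z := by
  simp only [opX, fderiv_fun_mul hF hG]
  simp
  ring

theorem opY_mul {F G : ℝ × ℝ → ℂ} {z : ℝ × ℝ} (hF : DifferentiableAt ℝ F z)
    (hG : DifferentiableAt ℝ G z) :
    opY (fun w => F w * G w) z = opY F z * G z + F z * opY G z := by
  simp only [opY, fderiv_fun_mul hF hG]
  simp
  ring

theorem opX_add {F G : ℝ × ℝ → ℂ} {z : ℝ × ℝ} (hF : DifferentiableAt ℝ F z)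
    (hG : DifferentiableAt ℝ G z) :
    opX (fun w => F w + G w) z = opX F z + opX G z := by
  simp only [opX, fderiv_fun_add hF hG]
  simp

theorem opY_add {F G : ℝ × ℝ → ℂ} {z : ℝ × ℝ} (hF : DifferentiableAt ℝ F z)
    (hG : DifferentiableAt ℝ G z) :
    opY (fun w => F w + G w) z = opY F z + opY G z := by
  simp only [opY, fderiv_fun_add hF hG]
  simp

theorem opX_const_mul {F : ℝ × ℝ → ℂ} {z : ℝ × ℝ} (c : ℂ) (hF : DifferentiableAt ℝ F z) :
    opX (fun w => c * F w) z = c * opX F z := by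
  rw [opX_mul (differentiableAt_const c) hF]
  simp [opX]

theorem opY_const_mul {F : ℝ × ℝ → ℂ} {z : ℝ × ℝ} (c : ℂ) (hF : DifferentiableAt ℝ F z) :
    opY (fun w => c * F w) z = c * opY F z := by
  rw [opY_mul (differentiableAt_const c) hF]
  simp [opY]

theorem opY_opX {F : ℝ × ℝ → ℂ} {U : Set (ℝ × ℝ)} (hU : IsOpen U)
    (hF : ContDiffOn ℝ ∞ F U) {z : ℝ × ℝ} (hz : z ∈ U) :
    opY (opX F) z = opX (opY F) z + opX F z := by
  have hc : ContDiffAt ℝ ∞ F z := hF.contDiffAt (hU.mem_nhds hz)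
  have hsym := hc.isSymmSndFDerivAt (by simpa using (WithTop.coe_le_coe.2 (le_top : (2 : ℕ∞) ≤ ⊤) : ((2 : ℕ∞) : WithTop ℕ∞) ≤ ∞))
  have hd : DifferentiableAt ℝ (fderiv ℝ F) z :=
    (hc.fderiv_right (m := ∞) (by simp)).differentiableAt (by simp)
  have key : ∀ v w : ℝ × ℝ, fderiv ℝ (fun z : ℝ × ℝ => z.2 • fderiv ℝ F z v) z w
      = z.2 • fderiv ℝ (fderiv ℝ F) z w v + w.2 • fderiv ℝ F z v := by
    intro v w
    have h1 : HasFDerivAt (fun z : ℝ × ℝ => fderiv ℝ F z v)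
        ((ContinuousLinearMap.apply ℝ ℂ v).comp (fderiv ℝ (fderiv ℝ F) z)) z :=
      (ContinuousLinearMap.apply ℝ ℂ v).hasFDerivAt.comp z hd.hasFDerivAt
    have h2 := (hasFDerivAt_snd (𝕜 := ℝ) (p := z)).smul h1
    have h3 := h2.fderiv
    simp only [Pi.smul_def'] at h3
    erw [h3]
    simp
  have e1 : opY (opX F) z = z.2 • (z.2 • fderiv ℝ (fderiv ℝ F) z (0, 1) (1, 0)
      + (1 : ℝ) • fderiv ℝ F z (1, 0)) := by
    rw [← key]; rfl
  have e2 : opX (opY F) z = z.2 • (z.2 • fderiv ℝ (fderiv ℝ F) z (1, 0) (0, 1)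
      + (0 : ℝ) • fderiv ℝ F z (0, 1)) := by
    rw [← key]; rfl
  rw [e1, e2, hsym.eq (0, 1) (1, 0)]
  simp [opX]

theorem opY_opX_iterate {F : ℝ × ℝ → ℂ} {U : Set (ℝ × ℝ)} (hU : IsOpen U)
    (hF : ContDiffOn ℝ ∞ F U) (c : ℂ) (h : ∀ z ∈ U, opY F z = c * F z) (n : ℕ) :
    ∀ z ∈ U, opY (opX^[n] F) z = (n + c) * opX^[n] F z := by
  induction n with
  | zero => simpa using h
  | succ n ih =>
    intro z hz
    have hs := contDiffOn_opX_iterate hU hF n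
    rw [Function.iterate_succ_apply', opY_opX hU hs hz]
    have : opY (opX^[n] F) =ᶠ[𝓝 z] fun w => (n + c) * opX^[n] F w :=
      Filter.eventually_of_mem (hU.mem_nhds hz) ih
    rw [opX_congr this, opX_const_mul]
    · push_cast; ring
    · exact (hs.contDiffAt (hU.mem_nhds hz)).differentiableAt (by simp)

theorem contDiff_Omega {ν : ℝ → ℝ} (hν : ContDiff ℝ ∞ ν) : ContDiff ℝ ∞ (Omega ν) :=
  Complex.ofRealCLM.contDiff.comp
    (((contDiff_snd.pow 2).mul (hν.comp contDiff_fst)).neg)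

theorem opY_Omega {ν : ℝ → ℝ} (hν : ContDiff ℝ ∞ ν) (z : ℝ × ℝ) :
    opY (Omega ν) z = 2 * Omega ν z := by
  have hd : HasDerivAt ν (deriv ν z.1) z.1 := (hν.differentiable (by simp) _).hasDerivAt
  have h1 : HasFDerivAt (fun z : ℝ × ℝ => ν z.1) _ z :=
    hd.hasFDerivAt.comp z (hasFDerivAt_fst (𝕜 := ℝ) (p := z))
  have h2 := (((hasFDerivAt_snd (𝕜 := ℝ) (p := z)).pow 2).mul h1).neg
  have h3 : HasFDerivAt (Omega ν) _ z := Complex.ofRealCLM.hasFDerivAt.comp z h2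
  rw [opY, h3.fderiv]
  simp [Omega]
  ring

theorem contDiff_rho {ν : ℝ → ℝ} (hν : ContDiff ℝ ∞ ν) (p : P) : ContDiff ℝ ∞ (rho ν p) := by
  induction p using MvPolynomial.induction_on with
  | C a => 
    have : rho ν (MvPolynomial.C a) = fun _ => a := by
      rw [← MvPolynomial.algebraMap_eq, AlgHom.commutes]; rfl
    rw [this]; exact contDiff_const
  | add p q hp hq => rw [map_add]; exact hp.add hq
  | mul_X p k hp =>
    rw [map_mul]
    refine hp.mul ?_
    rw [rho, MvPolynomial.aeval_X, ← contDiffOn_univ]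
    exact contDiffOn_opX_iterate isOpen_univ (contDiff_Omega hν).contDiffOn k

theorem rho_dX {ν : ℝ → ℝ} (hν : ContDiff ℝ ∞ ν) (p : P) (z : ℝ × ℝ) :
    rho ν (dX p) z = opX (rho ν p) z := by
  have hd : ∀ p, DifferentiableAt ℝ (rho ν p) z := fun p =>
    (contDiff_rho hν p).differentiable (by simp) z
  induction p using MvPolynomial.induction_on with
  | C a => 
    have : rho ν (MvPolynomial.C a) = fun _ => a := by
      rw [← MvPolynomial.algebraMap_eq, AlgHom.commutes]; rfl
    rw [this, ← MvPolynomial.algebraMap_eq, Derivation.map_algebraMap, map_zero]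
    simp [opX]
  | add p q hp hq =>
    rw [map_add, map_add, map_add]
    exact (congrArg₂ (· + ·) hp hq).trans (opX_add (hd p) (hd q)).symm
  | mul_X p k hp =>
    have e : rho ν (p * MvPolynomial.X k)
      = fun w => rho ν p w * rho ν (MvPolynomial.X k) w := by rw [map_mul]; rfl
    rw [e, opX_mul (hd p) (hd _), ← hp, Derivation.leibniz, dX, MvPolynomial.mkDerivation_X]
    simp only [smul_eq_mul, map_add, map_mul, Pi.add_apply, Pi.mul_apply]
    simp only [rho, MvPolynomial.aeval_X, Function.iterate_succ_apply']
    ring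

theorem rho_dY {ν : ℝ → ℝ} (hν : ContDiff ℝ ∞ ν) (p : P) (z : ℝ × ℝ) :
    rho ν (dY p) z = opY (rho ν p) z := by
  have hd : ∀ p, DifferentiableAt ℝ (rho ν p) z := fun p =>
    (contDiff_rho hν p).differentiable (by simp) z
  induction p using MvPolynomial.induction_on with
  | C a => 
    have : rho ν (MvPolynomial.C a) = fun _ => a := by
      rw [← MvPolynomial.algebraMap_eq, AlgHom.commutes]; rfl
    rw [this, ← MvPolynomial.algebraMap_eq, Derivation.map_algebraMap, map_zero]
    simp [opY]
  | add p q hp hq =>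
    rw [map_add, map_add, map_add]
    exact (congrArg₂ (· + ·) hp hq).trans (opY_add (hd p) (hd q)).symm
  | mul_X p k hp =>
    have e : rho ν (p * MvPolynomial.X k)
      = fun w => rho ν p w * rho ν (MvPolynomial.X k) w := by rw [map_mul]; rfl
    rw [e, opY_mul (hd p) (hd _), ← hp, Derivation.leibniz, dY, MvPolynomial.mkDerivation_X]
    simp only [smul_eq_mul, map_add, map_mul, Pi.add_apply, Pi.mul_apply, map_smul, Pi.smul_apply]
    simp only [rho, MvPolynomial.aeval_X]
    rw [opY_opX_iterate isOpen_univ (contDiff_Omega hν).contDiffOn 2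
      (fun w _ => opY_Omega hν w) k z trivial]
    ring


theorem contDiffOn_deriv_member {D : Datum} {φ : OpenPartialHomeomorph ℝ ℝ} (hφ : φ ∈ D.Γ) :
    ContDiffOn ℝ ∞ (deriv φ) φ.source :=
  ((contDiffOn_infty_iff_deriv_of_isOpen φ.open_source).1 (D.compat.smooth φ hφ)).2

theorem contDiffOn_deriv2_member {D : Datum} {φ : OpenPartialHomeomorph ℝ ℝ} (hφ : φ ∈ D.Γ) :
    ContDiffOn ℝ ∞ (deriv (deriv φ)) φ.source :=
  ((contDiffOn_infty_iff_deriv_of_isOpen φ.open_source).1 (contDiffOn_deriv_member hφ)).2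

theorem contDiffOn_ratio_member {D : Datum} {φ : OpenPartialHomeomorph ℝ ℝ} (hφ : φ ∈ D.Γ) :
    ContDiffOn ℝ ∞ (fun t => deriv (deriv φ) t / deriv φ t) φ.source :=
  (contDiffOn_deriv2_member hφ).div (contDiffOn_deriv_member hφ)
    fun x hx => (D.compat.deriv_pos φ hφ x hx).ne'

theorem hasDerivAt_member {D : Datum} {φ : OpenPartialHomeomorph ℝ ℝ} (hφ : φ ∈ D.Γ) {x : ℝ}
    (hx : x ∈ φ.source) : HasDerivAt φ (deriv φ x) x :=
  (((D.compat.smooth φ hφ).contDiffAt (φ.open_source.mem_nhds hx)).differentiableAt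
    (by simp)).hasDerivAt

theorem hasDerivAt_deriv_member {D : Datum} {φ : OpenPartialHomeomorph ℝ ℝ} (hφ : φ ∈ D.Γ)
    {x : ℝ} (hx : x ∈ φ.source) : HasDerivAt (deriv φ) (deriv (deriv φ) x) x :=
  (((contDiffOn_deriv_member hφ).contDiffAt (φ.open_source.mem_nhds hx)).differentiableAt
    (by simp)).hasDerivAt

theorem deriv_symm_mul {D : Datum} {φ : OpenPartialHomeomorph ℝ ℝ} (hφ : φ ∈ D.Γ) {y : ℝ}
    (hy : y ∈ φ.target) : deriv φ.symm y = (deriv φ (φ.symm y))⁻¹ := by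
  have hx : φ.symm y ∈ φ.source := φ.map_target hy
  exact (φ.hasDerivAt_symm hy (D.compat.deriv_pos φ hφ _ hx).ne' (hasDerivAt_member hφ hx)).deriv

theorem schwarzian_identity {D : Datum} {φ : OpenPartialHomeomorph ℝ ℝ} (hφ : φ ∈ D.Γ) {x : ℝ}
    (hx : x ∈ φ.source) :
    deriv (fun t => deriv (deriv φ) t / deriv φ t) x
      - 1 / 2 * (deriv (deriv φ) x / deriv φ x) ^ 2
      + D.ν x - (deriv φ x) ^ 2 * D.ν (φ x) = 0 := by
  have hne : ∀ x ∈ φ.source, deriv φ x ≠ 0 := fun x hx => (D.compat.deriv_pos φ hφ x hx).ne'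
  -- derivative of the lift
  have hL : ∀ z : ℝ × ℝ, z.1 ∈ φ.source → ∀ v : ℝ × ℝ, fderiv ℝ (cotLift φ) z v
      = (deriv φ z.1 * v.1, v.2 / deriv φ z.1
          - z.2 * deriv (deriv φ) z.1 * v.1 / (deriv φ z.1) ^ 2) := by
    intro z hz v
    have h1 : HasFDerivAt (fun z : ℝ × ℝ => φ z.1) _ z :=
      (hasDerivAt_member hφ hz).hasFDerivAt.comp z (hasFDerivAt_fst (𝕜 := ℝ) (p := z))
    have h2 : HasFDerivAt (fun z : ℝ × ℝ => (deriv φ z.1)⁻¹) _ z :=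
      ((hasDerivAt_deriv_member hφ hz).inv (hne _ hz)).hasFDerivAt.comp z
        (hasFDerivAt_fst (𝕜 := ℝ) (p := z))
    have h3 : HasFDerivAt (cotLift φ) _ z :=
      h1.prodMk ((hasFDerivAt_snd (𝕜 := ℝ) (p := z)).mul h2)
    rw [h3.fderiv]
    have := hne _ hz
    ext
    · simp [mul_comm]
    · simp
      field_simp
      ring
  set p : ℝ → ℝ := fun t => deriv (deriv φ) t / deriv φ t with hp
  let e : ℝ × ℝ → ℝ × ℝ := fun _ => (1, 0)
  have hV : ∀ w ∈ slab φ.symm, pushforward φ e w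
      = (deriv φ (φ.symm w.1), -(p (φ.symm w.1) * w.2)) := by
    rintro w ⟨hw, hw2⟩
    have hs : φ.symm w.1 ∈ φ.source := φ.map_target hw
    have := hne _ hs
    rw [pushforward, hL _ hs]
    simp only [cotLift, e, deriv_symm_mul hφ hw, hp]
    ext
    · simp
    · simp
      field_simp
  have hw : (φ x, (1 : ℝ)) ∈ slab φ.symm := ⟨φ.map_source hx, one_pos⟩
  have hxx : φ.symm (φ x) = x := φ.left_inv hx
  have key := D.compat.preserves φ hφ e e contDiffOn_const contDiffOn_const _ hw
  have hev : pushforward φ e =ᶠ[𝓝 (φ x, (1 : ℝ))]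
      fun w => (deriv φ (φ.symm w.1), -(p (φ.symm w.1) * w.2)) :=
    Filter.eventually_of_mem ((isOpen_slab _).mem_nhds hw) hV
  have hsymm : HasDerivAt φ.symm (deriv φ x)⁻¹ (φ x) := by
    have := φ.hasDerivAt_symm (φ.map_source hx) (f' := deriv φ x) (hne x hx)
      (by rw [hxx]; exact hasDerivAt_member hφ hx)
    exact this
  have hpd : HasDerivAt p (deriv p x) x :=
    (((contDiffOn_ratio_member hφ).contDiffAt (φ.open_source.mem_nhds hx)).differentiableAt
      (by simp)).hasDerivAt
  have hpc : HasDerivAt (fun s => p (φ.symm s)) (deriv p x * (deriv φ x)⁻¹) (φ x) := by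
    refine HasDerivAt.comp (h₂ := p) (φ x) ?_ hsymm
    rwa [hxx]
  have hdc : HasDerivAt (fun s => deriv φ (φ.symm s)) (deriv (deriv φ) x * (deriv φ x)⁻¹)
      (φ x) := by
    refine HasDerivAt.comp (h₂ := deriv φ) (φ x) ?_ hsymm
    rw [hxx]
    exact hasDerivAt_deriv_member hφ hx
  have hA : HasFDerivAt (fun w : ℝ × ℝ => deriv φ (φ.symm w.1)) _ (φ x, (1 : ℝ)) :=
    HasFDerivAt.comp (f := Prod.fst) (φ x, (1 : ℝ)) hdc.hasFDerivAt
      (hasFDerivAt_fst (𝕜 := ℝ) (p := (φ x, (1 : ℝ))))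
  have hB : HasFDerivAt (fun w : ℝ × ℝ => p (φ.symm w.1)) _ (φ x, (1 : ℝ)) :=
    HasFDerivAt.comp (f := Prod.fst) (φ x, (1 : ℝ)) hpc.hasFDerivAt
      (hasFDerivAt_fst (𝕜 := ℝ) (p := (φ x, (1 : ℝ))))
  have hF := (hA.prodMk (hB.mul (hasFDerivAt_snd (𝕜 := ℝ) (p := (φ x, (1 : ℝ))))).neg)
  have hfd := hev.fderiv_eq.trans hF.fderiv
  have key2 := congrArg Prod.snd key
  have hz0 : cotLift φ.symm (φ x, (1 : ℝ)) = (x, deriv φ x) := by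
    simp [cotLift, hxx, hsymm.deriv]
  rw [nabla, hfd, hev.eq_of_nhds] at key2
  rw [pushforward, hz0, hL _ hx] at key2
  simp [nabla, e, hxx] at key2
  have h0 := hne x hx
  field_simp at key2 ⊢
  simp only [hp] at key2 ⊢
  field_simp at key2 ⊢
  linarith

theorem hasFDerivAt_frameLift {D : Datum} {φ : OpenPartialHomeomorph ℝ ℝ} (hφ : φ ∈ D.Γ)
    {z : ℝ × ℝ} (hz : z.1 ∈ φ.source) :
    DifferentiableAt ℝ (frameLift φ) z ∧ ∀ v : ℝ × ℝ, fderiv ℝ (frameLift φ) z v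
      = (deriv φ z.1 * v.1, deriv φ z.1 * v.2 + deriv (deriv φ) z.1 * z.2 * v.1) := by
  have h1 : HasFDerivAt (fun z : ℝ × ℝ => φ z.1) _ z :=
    (hasDerivAt_member hφ hz).hasFDerivAt.comp z (hasFDerivAt_fst (𝕜 := ℝ) (p := z))
  have h2 : HasFDerivAt (fun z : ℝ × ℝ => deriv φ z.1) _ z :=
    (hasDerivAt_deriv_member hφ hz).hasFDerivAt.comp z (hasFDerivAt_fst (𝕜 := ℝ) (p := z))
  have h3 : HasFDerivAt (frameLift φ) _ z :=
    h1.prodMk (h2.mul (hasFDerivAt_snd (𝕜 := ℝ) (p := z)))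
  refine ⟨h3.differentiableAt, fun v => ?_⟩
  rw [h3.fderiv]
  ext
  · simp [mul_comm]
  · simp
    ring

theorem contDiffOn_frameLift {D : Datum} {φ : OpenPartialHomeomorph ℝ ℝ} (hφ : φ ∈ D.Γ) :
    ContDiffOn ℝ ∞ (frameLift φ) (slab φ) :=
  ((D.compat.smooth φ hφ).comp contDiffOn_fst fun _ h => h.1).prodMk
    (((contDiffOn_deriv_member hφ).comp contDiffOn_fst fun _ h => h.1).mul contDiffOn_snd)

theorem contDiffOn_muFn {D : Datum} {φ : OpenPartialHomeomorph ℝ ℝ} (hφ : φ ∈ D.Γ) :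
    ContDiffOn ℝ ∞ (muFn φ) (slab φ) :=
  Complex.ofRealCLM.contDiff.comp_contDiffOn
    (contDiffOn_snd.mul ((contDiffOn_ratio_member hφ).comp contDiffOn_fst fun _ h => h.1))

theorem contDiffOn_deltaFn {D : Datum} {φ : OpenPartialHomeomorph ℝ ℝ} (hφ : φ ∈ D.Γ) (n : ℕ) :
    ContDiffOn ℝ ∞ (deltaFn φ n) (slab φ) :=
  contDiffOn_opX_iterate (isOpen_slab φ) (contDiffOn_muFn hφ) n

theorem opX_comp_frameLift {D : Datum} {φ : OpenPartialHomeomorph ℝ ℝ} (hφ : φ ∈ D.Γ)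
    {G : ℝ × ℝ → ℂ} {z : ℝ × ℝ} (hz : z.1 ∈ φ.source)
    (hG : DifferentiableAt ℝ G (frameLift φ z)) :
    opX (fun w => G (frameLift φ w)) z
      = opX G (frameLift φ z) + muFn φ z * opY G (frameLift φ z) := by
  have h0 := (D.compat.deriv_pos φ hφ _ hz).ne'
  obtain ⟨hd, hf⟩ := hasFDerivAt_frameLift hφ hz
  have e := (hG.hasFDerivAt.comp z hd.hasFDerivAt).fderiv
  have e' : fderiv ℝ (fun w => G (frameLift φ w)) z
    = (fderiv ℝ G (frameLift φ z)).comp (fderiv ℝ (frameLift φ) z) := e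
  rw [opX, e', ContinuousLinearMap.comp_apply, hf]
  have : (((deriv (φ : ℝ → ℝ) z.1 : ℝ) * ((1:ℝ), (0:ℝ)).1, deriv φ z.1 * ((1:ℝ), (0:ℝ)).2
      + deriv (deriv φ) z.1 * z.2 * ((1:ℝ), (0:ℝ)).1) : ℝ × ℝ)
      = deriv φ z.1 • ((1:ℝ), (0:ℝ)) + (deriv (deriv φ) z.1 * z.2) • ((0:ℝ), (1:ℝ)) := by
    ext <;> simp
  rw [this, map_add, map_smul, map_smul]
  have hc : ((deriv φ z.1 : ℝ) : ℂ) ≠ 0 := by exact_mod_cast h0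
  simp [opX, opY, muFn, frameLift]
  field_simp

theorem opY_comp_frameLift {D : Datum} {φ : OpenPartialHomeomorph ℝ ℝ} (hφ : φ ∈ D.Γ)
    {G : ℝ × ℝ → ℂ} {z : ℝ × ℝ} (hz : z.1 ∈ φ.source)
    (hG : DifferentiableAt ℝ G (frameLift φ z)) :
    opY (fun w => G (frameLift φ w)) z = opY G (frameLift φ z) := by
  obtain ⟨hd, hf⟩ := hasFDerivAt_frameLift hφ hz
  have e' : fderiv ℝ (fun w => G (frameLift φ w)) z
    = (fderiv ℝ G (frameLift φ z)).comp (fderiv ℝ (frameLift φ) z) :=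
    (hG.hasFDerivAt.comp z hd.hasFDerivAt).fderiv
  rw [opY, e', ContinuousLinearMap.comp_apply, hf]
  have : (((deriv (φ : ℝ → ℝ) z.1 : ℝ) * ((0:ℝ), (1:ℝ)).1, deriv φ z.1 * ((0:ℝ), (1:ℝ)).2
      + deriv (deriv φ) z.1 * z.2 * ((0:ℝ), (1:ℝ)).1) : ℝ × ℝ)
      = deriv φ z.1 • ((0:ℝ), (1:ℝ)) := by
    ext <;> simp
  rw [this, map_smul]
  simp [opY, frameLift]
  ring

theorem opY_muFn {D : Datum} {φ : OpenPartialHomeomorph ℝ ℝ} (hφ : φ ∈ D.Γ) {z : ℝ × ℝ}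
    (hz : z.1 ∈ φ.source) :
    opY (muFn φ) z = muFn φ z ∧
      opX (muFn φ) z
        = ((z.2 ^ 2 * deriv (fun t => deriv (deriv φ) t / deriv φ t) z.1 : ℝ) : ℂ) := by
  have hd : HasDerivAt (fun t => deriv (deriv φ) t / deriv φ t) _ z.1 :=
    (((contDiffOn_ratio_member hφ).contDiffAt (φ.open_source.mem_nhds hz)).differentiableAt
      (by simp)).hasDerivAt
  have h1 : HasFDerivAt (fun z : ℝ × ℝ => deriv (deriv φ) z.1 / deriv φ z.1) _ z :=
    hd.hasFDerivAt.comp z (hasFDerivAt_fst (𝕜 := ℝ) (p := z))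
  have h3 : HasFDerivAt (muFn φ) _ z :=
    Complex.ofRealCLM.hasFDerivAt.comp z ((hasFDerivAt_snd (𝕜 := ℝ) (p := z)).mul h1)
  rw [opY, opX, h3.fderiv]
  constructor
  · simp [muFn]
  · simp
    ring

theorem opY_deltaFn {D : Datum} {φ : OpenPartialHomeomorph ℝ ℝ} (hφ : φ ∈ D.Γ) {z : ℝ × ℝ}
    (hz : z ∈ slab φ) (n : ℕ) : opY (deltaFn φ n) z = (n + 1) * deltaFn φ n z :=
  opY_opX_iterate (isOpen_slab φ) (contDiffOn_muFn hφ) 1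
    (fun w hw => by rw [(opY_muFn hφ hw.1).1, one_mul]) n z hz

theorem frameLift_congr {φ ψ : ℝ → ℝ} {z : ℝ × ℝ} (h : φ =ᶠ[𝓝 z.1] ψ) :
    frameLift φ z = frameLift ψ z := by
  simp only [frameLift, h.eq_of_nhds, h.deriv_eq]

theorem deltaFn_congr {φ ψ : ℝ → ℝ} {z : ℝ × ℝ} (h : φ =ᶠ[𝓝 z.1] ψ) (n : ℕ) :
    deltaFn φ n =ᶠ[𝓝 z] deltaFn ψ n := by
  induction n with
  | zero =>
    have h1 : ∀ᶠ w : ℝ × ℝ in 𝓝 z, φ =ᶠ[𝓝 w.1] ψ :=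
      continuous_fst.continuousAt.eventually h.eventually_nhds
    filter_upwards [h1] with w hw
    simp only [deltaFn, Function.iterate_zero, id, muFn, hw.deriv_eq, hw.deriv.deriv_eq]
  | succ n ih =>
    filter_upwards [ih.eventually_nhds] with w hw
    simp only [deltaFn, Function.iterate_succ_apply']
    exact opX_congr hw


/-! ### The groupoid algebra -/

/-- A monomial `f U_{φ⁻¹}` of the groupoid algebra: `φ ∈ Γ` and `f` is a smooth complex function
with compact support in `dom φ × (0, ∞)`. It is the function on the groupoid of germs that takes
the value `f (x, y)` at the germ of `φ` at `x` over `(x, y)`. -/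
@[ext]
structure Mono (D : Datum) where
  φ : OpenPartialHomeomorph ℝ ℝ
  f : ℝ × ℝ → ℂ
  mem : φ ∈ D.Γ
  smooth : ContDiff ℝ ∞ f
  compact : HasCompactSupport f
  supp : tsupport f ⊆ slab φ

theorem tsupport_convolution_subset {D : Datum} (m n : Mono D) :
    tsupport (fun z => m.f z * n.f (frameLift m.φ z))
      ⊆ tsupport m.f ∩ frameLift m.φ ⁻¹' tsupport n.f := by
  refine closure_minimal ?_ ?_
  · intro z hz
    have hz' : m.f z * n.f (frameLift m.φ z) ≠ 0 := hz
    exact ⟨subset_tsupport _ (left_ne_zero_of_mul hz'),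
      subset_tsupport _ (right_ne_zero_of_mul hz')⟩
  · exact ((contDiffOn_frameLift m.mem).continuousOn.mono m.supp).preimage_isClosed_of_isClosed
      (isClosed_tsupport _) (isClosed_tsupport _)

theorem convolution_supp {D : Datum} (m n : Mono D) :
    tsupport (fun z => m.f z * n.f (frameLift m.φ z)) ⊆ slab (m.φ.trans n.φ) := by
  intro z hz
  obtain ⟨h1, h2⟩ := tsupport_convolution_subset m n hz
  refine ⟨?_, (m.supp h1).2⟩
  rw [OpenPartialHomeomorph.trans_source]
  exact ⟨(m.supp h1).1, (n.supp h2).1⟩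

theorem contDiff_convolution {D : Datum} (m n : Mono D) :
    ContDiff ℝ ∞ fun z => m.f z * n.f (frameLift m.φ z) :=
  contDiff_mul_of_tsupport (isOpen_slab m.φ) m.smooth m.supp
    (n.smooth.comp_contDiffOn (contDiffOn_frameLift m.mem))

/-- `f U_{φ⁻¹} · g U_{ψ⁻¹} = f (g ∘ φ̃) U_{(ψ ∘ φ)⁻¹}`, `φ̃` being the lift to the frame bundle. -/
instance (D : Datum) : Mul (Mono D) where
  mul m n :=
    { φ := m.φ.trans n.φ
      f := fun z => m.f z * n.f (frameLift m.φ z)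
      mem := D.Γ.trans m.mem n.mem
      smooth := contDiff_convolution m n
      compact := m.compact.of_isClosed_subset (isClosed_tsupport _)
        fun _ hz => (tsupport_convolution_subset m n hz).1
      supp := convolution_supp m n }

theorem Mono.mul_φ {D : Datum} (m n : Mono D) : (m * n).φ = m.φ.trans n.φ := rfl

theorem Mono.mul_f {D : Datum} (m n : Mono D) (z : ℝ × ℝ) :
    (m * n).f z = m.f z * n.f (frameLift m.φ z) := rfl

/-- The linear relations between the monomials `f U_{φ⁻¹}`: they are linear in `f`, and depend only
on the germs of `φ` along the support of `f`. -/
inductive GroupoidRel (D : Datum) : (Mono D →₀ ℂ) → Prop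
  | add (m₁ m₂ m : Mono D) (h₁ : m₁.φ = m.φ) (h₂ : m₂.φ = m.φ) (hf : m.f = m₁.f + m₂.f) :
      GroupoidRel D (Finsupp.single m 1 - Finsupp.single m₁ 1 - Finsupp.single m₂ 1)
  | smul (c : ℂ) (m₁ m : Mono D) (h₁ : m₁.φ = m.φ) (hf : m.f = c • m₁.f) :
      GroupoidRel D (Finsupp.single m 1 - c • Finsupp.single m₁ 1)
  | germ (m₁ m : Mono D) (hf : m.f = m₁.f) (h : ∀ z ∈ tsupport m.f, m.φ =ᶠ[𝓝 z.1] m₁.φ) :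
      GroupoidRel D (Finsupp.single m 1 - Finsupp.single m₁ 1)

/-- The smooth groupoid algebra `C_c^∞(ℝ × ℝ⁺) ⋊ Γ` of the étale groupoid of germs of `Γ` acting on
the frame bundle: linear combinations of monomials `f U_{φ⁻¹}`, modulo the above relations. -/
def A (D : Datum) : Type := (Mono D →₀ ℂ) ⧸ Submodule.span ℂ {t | GroupoidRel D t}

instance (D : Datum) : AddCommGroup (A D) :=
  inferInstanceAs (AddCommGroup ((Mono D →₀ ℂ) ⧸ Submodule.span ℂ {t | GroupoidRel D t}))

instance (D : Datum) : Module ℂ (A D) :=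
  inferInstanceAs (Module ℂ ((Mono D →₀ ℂ) ⧸ Submodule.span ℂ {t | GroupoidRel D t}))

namespace A

variable {D : Datum}

/-- The projection from formal combinations of monomials. -/
def proj (D : Datum) : (Mono D →₀ ℂ) →ₗ[ℂ] A D :=
  Submodule.mkQ (Submodule.span ℂ {t | GroupoidRel D t})

/-- The class of a monomial. -/
def mk (m : Mono D) : A D := proj D (Finsupp.single m 1)

theorem proj_eq_zero {t : Mono D →₀ ℂ} (h : GroupoidRel D t) : proj D t = 0 :=
  (Submodule.Quotient.mk_eq_zero _).2 (Submodule.subset_span h)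

theorem mk_add (m₁ m₂ m : Mono D) (h₁ : m₁.φ = m.φ) (h₂ : m₂.φ = m.φ) (hf : m.f = m₁.f + m₂.f) :
    mk m = mk m₁ + mk m₂ := by
  have h := proj_eq_zero (.add m₁ m₂ m h₁ h₂ hf)
  rw [map_sub, map_sub, sub_sub, sub_eq_zero] at h
  exact h

theorem mk_smul (c : ℂ) (m₁ m : Mono D) (h₁ : m₁.φ = m.φ) (hf : m.f = c • m₁.f) :
    mk m = c • mk m₁ := by
  have h := proj_eq_zero (.smul c m₁ m h₁ hf)
  rw [map_sub, map_smul, sub_eq_zero] at h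
  exact h

theorem mk_germ (m₁ m : Mono D) (hf : m.f = m₁.f)
    (h : ∀ z ∈ tsupport m.f, m.φ =ᶠ[𝓝 z.1] m₁.φ) : mk m = mk m₁ := by
  have h := proj_eq_zero (.germ m₁ m hf h)
  rw [map_sub, sub_eq_zero] at h
  exact h

theorem mk_congr (m₁ m : Mono D) (h₁ : m₁.φ = m.φ) (hf : m.f = m₁.f) : mk m = mk m₁ :=
  mk_germ m₁ m hf fun z _ => by rw [h₁]

variable {M : Type*} [AddCommGroup M] [Module ℂ M]

theorem hom_ext {F G : A D →ₗ[ℂ] M} (h : ∀ m, F (mk m) = G (mk m)) : F = G := by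
  refine Submodule.linearMap_qext _ (Finsupp.lhom_ext' fun m => LinearMap.ext_ring ?_)
  exact h m

/-- Linear maps out of the groupoid algebra. -/
def lift (F : Mono D → M)
    (hadd : ∀ m₁ m₂ m : Mono D, m₁.φ = m.φ → m₂.φ = m.φ → m.f = m₁.f + m₂.f →
      F m = F m₁ + F m₂)
    (hsmul : ∀ (c : ℂ) (m₁ m : Mono D), m₁.φ = m.φ → m.f = c • m₁.f → F m = c • F m₁)
    (hgerm : ∀ m₁ m : Mono D, m.f = m₁.f → (∀ z ∈ tsupport m.f, m.φ =ᶠ[𝓝 z.1] m₁.φ) →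
      F m = F m₁) : A D →ₗ[ℂ] M :=
  Submodule.liftQ _ (Finsupp.linearCombination ℂ F) <| by
    rw [Submodule.span_le]
    rintro t (⟨m₁, m₂, m, h₁, h₂, hf⟩ | ⟨c, m₁, m, h₁, hf⟩ | ⟨m₁, m, hf, h⟩)
    · simp [hadd m₁ m₂ m h₁ h₂ hf]
    · simp [hsmul c m₁ m h₁ hf]
    · simp [hgerm m₁ m hf h]

theorem lift_mk (F : Mono D → M) (h₁ h₂ h₃) (m : Mono D) : lift F h₁ h₂ h₃ (mk m) = F m := by
  refine (Submodule.liftQ_apply _ _ _).trans ?_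
  simp

end A

/-- Left multiplication by a monomial. -/
def A.mulMono {D : Datum} (m : Mono D) : A D →ₗ[ℂ] A D :=
  A.lift (fun n => A.mk (m * n))
    (fun n₁ n₂ n h₁ h₂ hf => A.mk_add _ _ _ (by simp only [Mono.mul_φ, h₁])
      (by simp only [Mono.mul_φ, h₂])
      (by ext z; simp only [Mono.mul_f, Pi.add_apply, hf, mul_add]))
    (fun c n₁ n h₁ hf => A.mk_smul _ _ _ (by simp only [Mono.mul_φ, h₁])
      (by ext z; simp only [Mono.mul_f, Pi.smul_apply, smul_eq_mul, hf]; ring))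
    (fun n₁ n hf h => A.mk_germ _ _ (by ext z; simp only [Mono.mul_f, hf]) (by
      intro z hz
      obtain ⟨h1, h2⟩ := tsupport_convolution_subset m n hz
      have hc : ContinuousAt m.φ z.1 := m.φ.continuousAt (m.supp h1).1
      simp only [Mono.mul_φ, OpenPartialHomeomorph.coe_trans]
      exact hc.eventually (h _ h2)))

/-- The convolution product as a bilinear map. -/
def A.mulₗ (D : Datum) : A D →ₗ[ℂ] A D →ₗ[ℂ] A D :=
  A.lift A.mulMono
    (fun m₁ m₂ m h₁ h₂ hf => A.hom_ext fun n => by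
      simp only [A.mulMono, LinearMap.add_apply, A.lift_mk]
      refine A.mk_add _ _ _ (by simp only [Mono.mul_φ, h₁]) (by simp only [Mono.mul_φ, h₂]) ?_
      ext z
      simp only [Mono.mul_f, Pi.add_apply, hf, h₁, h₂, add_mul])
    (fun c m₁ m h₁ hf => A.hom_ext fun n => by
      simp only [A.mulMono, LinearMap.smul_apply, A.lift_mk]
      refine A.mk_smul _ _ _ (by simp only [Mono.mul_φ, h₁]) ?_
      ext z
      simp only [Mono.mul_f, Pi.smul_apply, hf, h₁, smul_eq_mul, mul_assoc])
    (fun m₁ m hf h => A.hom_ext fun n => by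
      simp only [A.mulMono, A.lift_mk]
      refine A.mk_germ _ _ ?_ ?_
      · ext z
        simp only [Mono.mul_f, hf]
        by_cases hz : z ∈ tsupport m.f
        · rw [frameLift_congr (h z hz)]
        · rw [← hf, image_eq_zero_of_notMem_tsupport hz, zero_mul, zero_mul]
      · intro z hz
        simp only [Mono.mul_φ, OpenPartialHomeomorph.coe_trans]
        exact (h z (tsupport_convolution_subset m n hz).1).fun_comp n.φ)

instance (D : Datum) : Mul (A D) := ⟨fun a b => A.mulₗ D a b⟩

theorem A.mul_def {D : Datum} (a b : A D) : a * b = A.mulₗ D a b := rfl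

theorem A.mk_mul_mk {D : Datum} (m n : Mono D) : A.mk m * A.mk n = A.mk (m * n) := by
  rw [A.mul_def, A.mulₗ, A.lift_mk, A.mulMono, A.lift_mk]

theorem A.induction {D : Datum} {p : A D → Prop} (a : A D) (h0 : p 0)
    (hmk : ∀ (c : ℂ) m, p (c • A.mk m)) (hadd : ∀ a b, p a → p b → p (a + b)) : p a := by
  obtain ⟨t, rfl⟩ := Submodule.mkQ_surjective _ a
  change p (A.proj D t)
  induction t using Finsupp.induction_linear with
  | zero => rw [map_zero]; exact h0
  | add s t hs ht => rw [map_add]; exact hadd _ _ hs ht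
  | single m c =>
    have : A.proj D (Finsupp.single m c) = c • A.mk m := by
      rw [A.mk, ← map_smul, Finsupp.smul_single, smul_eq_mul, mul_one]
    rw [this]; exact hmk c m

theorem frameLift_trans {D : Datum} (m n : Mono D) {z : ℝ × ℝ} (hz : z ∈ slab m.φ)
    (hz' : m.φ z.1 ∈ n.φ.source) :
    frameLift (m.φ.trans n.φ) z = frameLift n.φ (frameLift m.φ z) := by
  have h := (hasDerivAt_member n.mem hz').comp z.1 (hasDerivAt_member m.mem hz.1)
  simp only [frameLift, OpenPartialHomeomorph.coe_trans, h.deriv, Function.comp_apply]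
  ext
  · rfl
  · simp only; ring

instance (D : Datum) : NonUnitalRing (A D) where
  left_distrib a b c := by simp only [A.mul_def, map_add]
  right_distrib a b c := by simp only [A.mul_def, map_add, LinearMap.add_apply]
  zero_mul a := by simp only [A.mul_def, map_zero, LinearMap.zero_apply]
  mul_zero a := by simp only [A.mul_def, map_zero]
  mul_assoc a b c := by
    induction a using A.induction with
    | h0 => simp only [A.mul_def, map_zero, LinearMap.zero_apply]
    | hadd a a' h h' =>
      simp only [A.mul_def, map_add, LinearMap.add_apply] at h h' ⊢; rw [h, h']
    | hmk r m =>
    induction b using A.induction with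
    | h0 => simp only [A.mul_def, map_zero, LinearMap.zero_apply]
    | hadd a a' h h' =>
      simp only [A.mul_def, map_add, LinearMap.add_apply] at h h' ⊢; rw [h, h']
    | hmk s n =>
    induction c using A.induction with
    | h0 => simp only [A.mul_def, map_zero]
    | hadd a a' h h' => simp only [A.mul_def, map_add] at h h' ⊢; rw [h, h']
    | hmk t k =>
    have key : A.mk m * A.mk n * A.mk k = A.mk m * (A.mk n * A.mk k) := by
      simp only [A.mk_mul_mk]
      refine A.mk_congr _ _ ?_ ?_
      · simp only [Mono.mul_φ, OpenPartialHomeomorph.trans_assoc]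
      · ext z
        simp only [Mono.mul_f, Mono.mul_φ]
        by_cases hm : m.f z = 0
        · simp [hm]
        by_cases hn : n.f (frameLift m.φ z) = 0
        · simp [hn]
        rw [frameLift_trans m n (m.supp (subset_tsupport _ hm))
          (n.supp (subset_tsupport _ hn)).1]
        ring
    simp only [A.mul_def, map_smul, LinearMap.smul_apply] at key ⊢
    rw [key]

instance (D : Datum) : IsScalarTower ℂ (A D) (A D) :=
  ⟨fun c a b => by simp only [smul_eq_mul, A.mul_def, map_smul, LinearMap.smul_apply]⟩

instance (D : Datum) : SMulCommClass ℂ (A D) (A D) :=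
  ⟨fun c a b => by simp only [smul_eq_mul, A.mul_def, map_smul]⟩

/-! ### The operators `X`, `Y`, `δ_n` and multiplication by functions -/

theorem opX_eq_zero {f : ℝ × ℝ → ℂ} {z : ℝ × ℝ} (hz : z ∉ tsupport f) : opX f z = 0 := by
  have := notMem_tsupport_iff_eventuallyEq.mp hz
  rw [opX_congr this]
  simp [opX]

theorem opY_eq_zero {f : ℝ × ℝ → ℂ} {z : ℝ × ℝ} (hz : z ∉ tsupport f) : opY f z = 0 := by
  have := notMem_tsupport_iff_eventuallyEq.mp hz
  rw [opY_congr this]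
  simp [opY]

theorem tsupport_opX_subset (f : ℝ × ℝ → ℂ) : tsupport (opX f) ⊆ tsupport f :=
  closure_minimal (fun _ hz => by_contra fun h => hz (opX_eq_zero h)) (isClosed_tsupport f)

theorem tsupport_opY_subset (f : ℝ × ℝ → ℂ) : tsupport (opY f) ⊆ tsupport f :=
  closure_minimal (fun _ hz => by_contra fun h => hz (opY_eq_zero h)) (isClosed_tsupport f)

theorem contDiff_opX {f : ℝ × ℝ → ℂ} (h : ContDiff ℝ ∞ f) : ContDiff ℝ ∞ (opX f) :=
  contDiffOn_univ.1 (contDiffOn_opX isOpen_univ h.contDiffOn)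

theorem contDiff_opY {f : ℝ × ℝ → ℂ} (h : ContDiff ℝ ∞ f) : ContDiff ℝ ∞ (opY f) :=
  contDiffOn_univ.1 (contDiffOn_opY isOpen_univ h.contDiffOn)

namespace Mono

variable {D : Datum}

theorem diff (m : Mono D) : Differentiable ℝ m.f := m.smooth.differentiable (by simp)

/-- `X (f U) = X(f) U`. -/
def X (m : Mono D) : Mono D where
  φ := m.φ
  f := opX m.f
  mem := m.mem
  smooth := contDiff_opX m.smooth
  compact := m.compact.of_isClosed_subset (isClosed_tsupport _) (tsupport_opX_subset _)
  supp := (tsupport_opX_subset _).trans m.supp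

/-- `Y (f U) = Y(f) U`. -/
def Y (m : Mono D) : Mono D where
  φ := m.φ
  f := opY m.f
  mem := m.mem
  smooth := contDiff_opY m.smooth
  compact := m.compact.of_isClosed_subset (isClosed_tsupport _) (tsupport_opY_subset _)
  supp := (tsupport_opY_subset _).trans m.supp

end Mono

/-- A smooth function on the groupoid of germs, by which `f U_{φ⁻¹}` can be multiplied pointwise. -/
structure Multiplier (D : Datum) where
  G : (ℝ → ℝ) → ℝ × ℝ → ℂ
  smooth : ∀ φ ∈ D.Γ, ContDiffOn ℝ ∞ (G φ) (slab φ)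
  congr : ∀ (φ ψ : ℝ → ℝ) (z : ℝ × ℝ), φ =ᶠ[𝓝 z.1] ψ → G φ z = G ψ z

theorem tsupport_mul_subset (f G : ℝ × ℝ → ℂ) : tsupport (fun z => f z * G z) ⊆ tsupport f :=
  closure_mono fun _ hz => left_ne_zero_of_mul hz

/-- Pointwise multiplication: `f U_{φ⁻¹} ↦ f G_φ U_{φ⁻¹}`. -/
def Mono.multiply {D : Datum} (M : Multiplier D) (m : Mono D) : Mono D where
  φ := m.φ
  f := fun z => m.f z * M.G m.φ z
  mem := m.mem
  smooth := contDiff_mul_of_tsupport (isOpen_slab m.φ) m.smooth m.supp (M.smooth _ m.mem)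
  compact := m.compact.of_isClosed_subset (isClosed_tsupport _) (tsupport_mul_subset _ _)
  supp := (tsupport_mul_subset _ _).trans m.supp

namespace A

variable {D : Datum}

/-- The operator `X`. -/
def X (D : Datum) : A D →ₗ[ℂ] A D :=
  lift (fun m => mk m.X)
    (fun m₁ m₂ m h₁ h₂ hf => mk_add _ _ _ h₁ h₂ (by
      ext z
      simp only [Mono.X, hf]
      exact opX_add (m₁.diff z) (m₂.diff z)))
    (fun c m₁ m h₁ hf => mk_smul _ _ _ h₁ (by
      ext z
      simp only [Mono.X, hf]
      exact opX_const_mul c (m₁.diff z)))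
    (fun m₁ m hf h => mk_germ _ _ (by simp only [Mono.X, hf])
      fun z hz => h z (tsupport_opX_subset _ hz))

/-- The operator `Y`. -/
def Y (D : Datum) : A D →ₗ[ℂ] A D :=
  lift (fun m => mk m.Y)
    (fun m₁ m₂ m h₁ h₂ hf => mk_add _ _ _ h₁ h₂ (by
      ext z
      simp only [Mono.Y, hf]
      exact opY_add (m₁.diff z) (m₂.diff z)))
    (fun c m₁ m h₁ hf => mk_smul _ _ _ h₁ (by
      ext z
      simp only [Mono.Y, hf]
      exact opY_const_mul c (m₁.diff z)))
    (fun m₁ m hf h => mk_germ _ _ (by simp only [Mono.Y, hf])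
      fun z hz => h z (tsupport_opY_subset _ hz))

/-- The operator of pointwise multiplication. -/
def multiply (M : Multiplier D) : A D →ₗ[ℂ] A D :=
  lift (fun m => mk (m.multiply M))
    (fun m₁ m₂ m h₁ h₂ hf => mk_add _ _ _ h₁ h₂ (by
      ext z
      simp only [Mono.multiply, hf, h₁, h₂, Pi.add_apply, add_mul]))
    (fun c m₁ m h₁ hf => mk_smul _ _ _ h₁ (by
      ext z
      simp only [Mono.multiply, hf, h₁, Pi.smul_apply, smul_eq_mul, mul_assoc]))
    (fun m₁ m hf h => mk_germ _ _ (by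
      ext z
      simp only [Mono.multiply]
      by_cases hz : z ∈ tsupport m.f
      · rw [M.congr _ _ z (h z hz), hf]
      · rw [← hf, image_eq_zero_of_notMem_tsupport hz, zero_mul, zero_mul])
      fun z hz => h z (tsupport_mul_subset _ _ hz))

theorem X_mk (m : Mono D) : X D (mk m) = mk m.X := lift_mk _ _ _ _ m

theorem Y_mk (m : Mono D) : Y D (mk m) = mk m.Y := lift_mk _ _ _ _ m

theorem multiply_mk (M : Multiplier D) (m : Mono D) : multiply M (mk m) = mk (m.multiply M) :=
  lift_mk _ _ _ _ m

/-- The function `X ^ n (y φ'' / φ')`. -/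
def deltaMultiplier (D : Datum) (n : ℕ) : Multiplier D where
  G φ := deltaFn φ n
  smooth _ hφ := contDiffOn_deltaFn hφ n
  congr _ _ _ h := (deltaFn_congr h n).eq_of_nhds

/-- `ρ(p) · f U_{φ⁻¹} = ρ(p) f U_{φ⁻¹}`. -/
def leftMultiplier (D : Datum) (p : P) : Multiplier D where
  G _ := rho D.ν p
  smooth _ _ := (contDiff_rho D.smooth p).contDiffOn
  congr _ _ _ _ := rfl

/-- `f U_{φ⁻¹} · ρ(p) = f (ρ(p) ∘ φ̃) U_{φ⁻¹}`. -/
def rightMultiplier (D : Datum) (p : P) : Multiplier D where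
  G φ z := rho D.ν p (frameLift φ z)
  smooth _ hφ := (contDiff_rho D.smooth p).comp_contDiffOn (contDiffOn_frameLift hφ)
  congr _ _ z h := by rw [frameLift_congr h]

/-- The operator `δ_{n+1}`. -/
def delta (D : Datum) (n : ℕ) : A D →ₗ[ℂ] A D := multiply (deltaMultiplier D n)

/-- The operator `a ↦ ρ(p) a`. -/
def left (D : Datum) (p : P) : A D →ₗ[ℂ] A D := multiply (leftMultiplier D p)

/-- The operator `a ↦ a ρ(p)`. -/
def right (D : Datum) (p : P) : A D →ₗ[ℂ] A D := multiply (rightMultiplier D p)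

theorem right_mul (p : P) (a b : A D) : right D p a * b = a * left D p b := by
  have : (mulₗ D).comp (right D p)
      = LinearMap.compl₂ (mulₗ D) (left D p) :=
    hom_ext fun m => hom_ext fun n => by
      simp only [LinearMap.comp_apply, LinearMap.compl₂_apply, right, left, multiply_mk, ← mul_def,
        mk_mul_mk]
      refine mk_congr _ _ rfl ?_
      ext z
      simp only [Mono.mul_f, Mono.multiply, rightMultiplier, leftMultiplier]
      ring
  exact congrArg (fun F => F a b) this

theorem left_mul (p : P) (a b : A D) : left D p (a * b) = left D p a * b := by
  have : (mulₗ D).compr₂ (left D p) = (mulₗ D).comp (left D p) :=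
    hom_ext fun m => hom_ext fun n => by
      simp only [LinearMap.comp_apply, LinearMap.compr₂_apply, left, multiply_mk, ← mul_def,
        mk_mul_mk]
      refine mk_congr _ _ rfl ?_
      ext z
      simp only [Mono.mul_f, Mono.multiply, leftMultiplier]
      ring
  exact congrArg (fun F => F a b) this

end A

/-! ### The actions -/

/-- The action of the generators. -/
def genAction (D : Datum) : Gen → Module.End ℂ (A D)
  | .X => A.X D
  | .Y => A.Y D
  | .delta n => A.delta D n
  | .alpha p => A.left D p
  | .beta p => A.right D p

theorem mulG_diff {D : Datum} (M : Multiplier D) (m : Mono D) {z : ℝ × ℝ} (hz : z ∈ tsupport m.f) :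
    DifferentiableAt ℝ (M.G m.φ) z :=
  ((M.smooth _ m.mem).contDiffAt ((isOpen_slab _).mem_nhds (m.supp hz))).differentiableAt (by simp)

theorem X_multiply {D : Datum} (M N : Multiplier D)
    (h : ∀ φ ∈ D.Γ, ∀ z ∈ slab φ, opX (M.G φ) z = N.G φ z) (a : A D) :
    A.X D (A.multiply M a) = A.multiply M (A.X D a) + A.multiply N a := by
  have : (A.X D).comp (A.multiply M) = (A.multiply M).comp (A.X D) + A.multiply N :=
    A.hom_ext fun m => by
      simp only [LinearMap.comp_apply, LinearMap.add_apply, A.multiply_mk, A.X_mk]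
      refine A.mk_add _ _ _ rfl rfl ?_
      ext z
      simp only [Mono.multiply, Mono.X, Pi.add_apply]
      by_cases hz : z ∈ tsupport m.f
      · rw [opX_mul (m.diff z) (mulG_diff M m hz), h _ m.mem z (m.supp hz)]
      · rw [opX_eq_zero fun h => hz (tsupport_mul_subset _ _ h), opX_eq_zero hz,
          image_eq_zero_of_notMem_tsupport hz]
        simp
  exact congrArg (fun F => F a) this

theorem Y_multiply {D : Datum} (M N : Multiplier D)
    (h : ∀ φ ∈ D.Γ, ∀ z ∈ slab φ, opY (M.G φ) z = N.G φ z) (a : A D) :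
    A.Y D (A.multiply M a) = A.multiply M (A.Y D a) + A.multiply N a := by
  have : (A.Y D).comp (A.multiply M) = (A.multiply M).comp (A.Y D) + A.multiply N :=
    A.hom_ext fun m => by
      simp only [LinearMap.comp_apply, LinearMap.add_apply, A.multiply_mk, A.Y_mk]
      refine A.mk_add _ _ _ rfl rfl ?_
      ext z
      simp only [Mono.multiply, Mono.Y, Pi.add_apply]
      by_cases hz : z ∈ tsupport m.f
      · rw [opY_mul (m.diff z) (mulG_diff M m hz), h _ m.mem z (m.supp hz)]
      · rw [opY_eq_zero fun h => hz (tsupport_mul_subset _ _ h), opY_eq_zero hz,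
          image_eq_zero_of_notMem_tsupport hz]
        simp
  exact congrArg (fun F => F a) this

namespace Multiplier

variable {D : Datum}

instance : Add (Multiplier D) where
  add M N :=
    { G := fun φ z => M.G φ z + N.G φ z
      smooth := fun φ hφ => (M.smooth φ hφ).add (N.smooth φ hφ)
      congr := fun φ ψ z h => by rw [M.congr φ ψ z h, N.congr φ ψ z h] }

instance : Mul (Multiplier D) where
  mul M N :=
    { G := fun φ z => M.G φ z * N.G φ z
      smooth := fun φ hφ => (M.smooth φ hφ).mul (N.smooth φ hφ)
      congr := fun φ ψ z h => by rw [M.congr φ ψ z h, N.congr φ ψ z h] }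

instance : SMul ℂ (Multiplier D) where
  smul c M :=
    { G := fun φ z => c * M.G φ z
      smooth := fun φ hφ => contDiffOn_const.mul (M.smooth φ hφ)
      congr := fun φ ψ z h => by rw [M.congr φ ψ z h] }

end Multiplier

section

variable {D : Datum}

theorem multiply_ext (M N : Multiplier D) (h : ∀ φ ∈ D.Γ, ∀ z ∈ slab φ, M.G φ z = N.G φ z) :
    A.multiply M = A.multiply N :=
  A.hom_ext fun m => by
    simp only [A.multiply_mk]
    refine A.mk_congr _ _ rfl ?_
    ext z
    simp only [Mono.multiply]
    by_cases hz : z ∈ tsupport m.f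
    · rw [h _ m.mem z (m.supp hz)]
    · rw [image_eq_zero_of_notMem_tsupport hz, zero_mul, zero_mul]

theorem multiply_add (M N : Multiplier D) :
    A.multiply (M + N) = A.multiply M + A.multiply N :=
  A.hom_ext fun m => by
    simp only [A.multiply_mk, LinearMap.add_apply]
    refine A.mk_add _ _ _ rfl rfl ?_
    ext z
    exact mul_add _ _ _

theorem multiply_smul (c : ℂ) (M : Multiplier D) :
    A.multiply (c • M) = c • A.multiply M :=
  A.hom_ext fun m => by
    simp only [A.multiply_mk, LinearMap.smul_apply]
    refine A.mk_smul _ _ _ rfl ?_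
    ext z
    exact mul_left_comm _ _ _

theorem multiply_mul (M N : Multiplier D) :
    A.multiply (M * N) = A.multiply M * A.multiply N :=
  A.hom_ext fun m => by
    simp only [A.multiply_mk, Module.End.mul_apply]
    refine A.mk_congr _ _ rfl ?_
    ext z
    change m.f z * (M.G m.φ z * N.G m.φ z) = m.f z * N.G m.φ z * M.G m.φ z
    ring

theorem multiply_comm (M N : Multiplier D) :
    A.multiply M * A.multiply N = A.multiply N * A.multiply M := by
  rw [← multiply_mul, ← multiply_mul]
  exact multiply_ext _ _ fun _ _ _ _ => mul_comm _ _

theorem Y_X_comm : A.Y D * A.X D = A.X D * A.Y D + A.X D :=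
  A.hom_ext fun m => by
    simp only [Module.End.mul_apply, LinearMap.add_apply, A.X_mk, A.Y_mk]
    refine A.mk_add _ _ _ rfl rfl ?_
    ext z
    exact opY_opX isOpen_univ m.smooth.contDiffOn (Set.mem_univ z)

theorem rho_C (ν : ℝ → ℝ) (c : ℂ) (z : ℝ × ℝ) : rho ν (MvPolynomial.C c) z = c := by
  rw [← MvPolynomial.algebraMap_eq, AlgHom.commutes]; rfl

theorem multiply_const (c : ℂ) (M : Multiplier D) (h : ∀ φ z, M.G φ z = c) :
    A.multiply M = algebraMap ℂ (Module.End ℂ (A D)) c :=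
  A.hom_ext fun m => by
    simp only [A.multiply_mk, Module.algebraMap_end_apply]
    refine A.mk_smul _ _ _ rfl ?_
    ext z
    simp only [Mono.multiply, h, Pi.smul_apply, smul_eq_mul, mul_comm]

open Multiplier A in
theorem genAction_rel {x y : FreeAlgebra ℂ Gen} (h : Rel1 x y) :
    FreeAlgebra.lift ℂ (genAction D) x = FreeAlgebra.lift ℂ (genAction D) y := by
  have hrho : ∀ p z, DifferentiableAt ℝ (rho D.ν p) z := fun p z =>
    (contDiff_rho D.smooth p).differentiable (by simp) z
  induction h with
  | Y_X => simpa [genAction] using Y_X_comm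
  | X_delta n =>
    simp only [map_mul, map_add, FreeAlgebra.lift_ι_apply, genAction]
    ext a
    refine X_multiply _ _ (fun φ hφ z hz => ?_) a
    simp only [deltaMultiplier, deltaFn, Function.iterate_succ_apply']
  | Y_delta n =>
    simp only [map_mul, map_add, map_smul, FreeAlgebra.lift_ι_apply, genAction]
    ext a
    have := Y_multiply (deltaMultiplier D n) (((n : ℂ) + 1) • deltaMultiplier D n)
      (fun φ hφ z hz => opY_deltaFn hφ hz n) a
    rw [multiply_smul] at this
    exact this
  | delta_delta n m =>
    simp only [map_mul, FreeAlgebra.lift_ι_apply, genAction]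
    exact multiply_comm _ _
  | alpha_const c =>
    simp only [FreeAlgebra.lift_ι_apply, genAction, AlgHom.commutes]
    exact multiply_const c _ fun φ z => rho_C _ _ _
  | alpha_add p q =>
    simp only [map_add, FreeAlgebra.lift_ι_apply, genAction]
    refine Eq.trans ?_ (multiply_add _ _)
    exact multiply_ext _ _ fun φ _ z _ => congrFun (map_add (rho D.ν) p q) z
  | alpha_mul p q =>
    simp only [map_mul, FreeAlgebra.lift_ι_apply, genAction]
    refine Eq.trans ?_ (multiply_mul _ _)
    exact multiply_ext _ _ fun φ _ z _ => congrFun (map_mul (rho D.ν) p q) z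
  | beta_const c =>
    simp only [FreeAlgebra.lift_ι_apply, genAction, AlgHom.commutes]
    exact multiply_const c _ fun φ z => rho_C _ _ _
  | beta_add p q =>
    simp only [map_add, FreeAlgebra.lift_ι_apply, genAction]
    refine Eq.trans ?_ (multiply_add _ _)
    exact multiply_ext _ _ fun φ _ z _ => congrFun (map_add (rho D.ν) p q) _
  | beta_mul p q =>
    simp only [map_mul, FreeAlgebra.lift_ι_apply, genAction]
    refine Eq.trans ?_ (multiply_mul _ _)
    exact multiply_ext _ _ fun φ _ z _ => congrFun (map_mul (rho D.ν) p q) _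
  | alpha_beta p q =>
    simp only [map_mul, FreeAlgebra.lift_ι_apply, genAction]
    exact multiply_comm _ _
  | X_alpha p =>
    simp only [map_mul, map_add, FreeAlgebra.lift_ι_apply, genAction]
    ext a
    exact X_multiply _ _ (fun φ hφ z hz => (rho_dX D.smooth p z).symm) a
  | Y_alpha p =>
    simp only [map_mul, map_add, FreeAlgebra.lift_ι_apply, genAction]
    ext a
    exact Y_multiply _ _ (fun φ hφ z hz => (rho_dY D.smooth p z).symm) a
  | delta_alpha n p =>
    simp only [map_mul, FreeAlgebra.lift_ι_apply, genAction]
    exact multiply_comm _ _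
  | X_beta q =>
    simp only [map_mul, map_add, FreeAlgebra.lift_ι_apply, genAction, add_assoc]
    ext a
    have := X_multiply (rightMultiplier D q)
      (rightMultiplier D (dX q) + rightMultiplier D (dY q) * deltaMultiplier D 0)
      (fun φ hφ z hz => by
        refine (opX_comp_frameLift hφ hz.1 (hrho q _)).trans ?_
        rw [← rho_dX D.smooth, ← rho_dY D.smooth, mul_comm]
        rfl) a
    rw [multiply_add, multiply_mul] at this
    exact this
  | Y_beta q =>
    simp only [map_mul, map_add, FreeAlgebra.lift_ι_apply, genAction]
    ext a
    refine Y_multiply _ _ (fun φ hφ z hz => ?_) a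
    refine (opY_comp_frameLift hφ hz.1 (hrho q _)).trans ?_
    rw [← rho_dY D.smooth]
    rfl
  | delta_beta n q =>
    simp only [map_mul, FreeAlgebra.lift_ι_apply, genAction]
    exact multiply_comm _ _

/-- The action of `P ⋊ H₁ ⋉ P`, `(p ⋊ h ⋉ q) a = ρ(p) h(a) ρ(q)`. -/
def chiTilde (D : Datum) : H1tilde →ₐ[ℂ] Module.End ℂ (A D) :=
  RingQuot.liftAlgHom ℂ ⟨FreeAlgebra.lift ℂ (genAction D), fun _ _ h => genAction_rel h⟩

theorem chiTilde_gen (D : Datum) (g : Gen) : chiTilde D (H1tilde.gen g) = genAction D g :=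
  (RingQuot.liftAlgHom_mkAlgHom_apply ℂ _ _ _).trans (FreeAlgebra.lift_ι_apply _ _)

theorem rho_X (ν : ℝ → ℝ) (k : ℕ) : rho ν (MvPolynomial.X k) = opX^[k] (Omega ν) :=
  MvPolynomial.aeval_X _ _

open A in
theorem chiTilde_rel {x y : H1tilde} (h : RelS x y) : chiTilde D x = chiTilde D y := by
  obtain ⟨⟩ := h
  simp only [map_add, map_sub, map_smul, map_pow, map_zero, chiTilde_gen, genAction]
  have e : A.delta D 1 - (1 / 2 : ℂ) • A.delta D 0 ^ 2 - A.left D (MvPolynomial.X 0)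
      + A.right D (MvPolynomial.X 0)
      = A.multiply (deltaMultiplier D 1 + (-(1 / 2) : ℂ) • (deltaMultiplier D 0 * deltaMultiplier D 0)
        + (-1 : ℂ) • leftMultiplier D (MvPolynomial.X 0)
        + rightMultiplier D (MvPolynomial.X 0)) := by
    simp only [multiply_add, multiply_smul, multiply_mul, pow_two]
    simp only [delta, left, right]
    module
  rw [e]
  refine ((multiply_ext _ ⟨fun _ _ => 0, fun _ _ => contDiffOn_const, fun _ _ _ _ => rfl⟩
    fun φ hφ z hz => ?_).trans (multiply_const 0 _ fun _ _ => rfl)).trans (map_zero _)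
  change deltaFn φ 1 z + -(1 / 2) * (deltaFn φ 0 z * deltaFn φ 0 z)
    + -1 * rho D.ν (MvPolynomial.X 0) z + rho D.ν (MvPolynomial.X 0) (frameLift φ z) = 0
  have e1 : deltaFn φ 1 z = opX (muFn φ) z := rfl
  have e0 : deltaFn φ 0 z = muFn φ z := rfl
  have eO : ∀ w, rho D.ν (MvPolynomial.X 0) w = Omega D.ν w := fun w => by rw [rho_X]; rfl
  rw [e1, e0, eO, eO, (opY_muFn hφ hz.1).2]
  have key := congrArg (fun t : ℝ => ((z.2 ^ 2 * t : ℝ) : ℂ)) (schwarzian_identity hφ hz.1)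
  simp only [mul_zero] at key
  simp only [muFn, Omega, frameLift]
  push_cast at key ⊢
  rw [← key]
  ring

/-- The induced action of the quotient. -/
def chiOne (D : Datum) : Hs →ₐ[ℂ] Module.End ℂ (A D) :=
  RingQuot.liftAlgHom ℂ ⟨chiTilde D, fun _ _ h => chiTilde_rel h⟩

theorem chiOne_gen (D : Datum) (g : Gen) : chiOne D (Hs.gen g) = genAction D g :=
  (RingQuot.liftAlgHom_mkAlgHom_apply ℂ _ _ _).trans (chiTilde_gen D g)

/-- The product `(a₀, ..., aₙ) ↦ a₀ ⋯ aₙ`. -/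
def mulAll (D : Datum) : (n : ℕ) → MultilinearMap ℂ (fun _ : Fin (n + 1) => A D) (A D)
  | 0 =>
    haveI : Subsingleton (Fin (0 + 1)) := inferInstanceAs (Subsingleton (Fin 1))
    MultilinearMap.ofSubsingleton ℂ (A D) (A D) 0 LinearMap.id
  | n + 1 => LinearMap.uncurryLeft
      { toFun := fun a => (LinearMap.mulLeft ℂ a).compMultilinearMap (mulAll D n)
        map_add' := fun a b => by ext v; exact add_mul a b _
        map_smul' := fun c a => by ext v; exact smul_mul_assoc c a _ }

theorem mulAll_zero (D : Datum) (a : Fin 1 → A D) : mulAll D 0 a = a 0 := rfl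

theorem mulAll_succ (D : Datum) (n : ℕ) (a : Fin (n + 2) → A D) :
    mulAll D (n + 1) a = a 0 * mulAll D n (Fin.tail a) := rfl

theorem mulAll_left (n : ℕ) (p : P) (a : Fin (n + 1) → A D) :
    mulAll D n (Function.update a 0 (A.left D p (a 0))) = A.left D p (mulAll D n a) := by
  cases n with
  | zero => simp [mulAll_zero]
  | succ n => simp [mulAll_succ, A.left_mul]

theorem mulAll_balanced (n : ℕ) (p : P) (a : Fin (n + 1) → A D) (i : Fin n) :
    mulAll D n (Function.update a i.castSucc (A.right D p (a i.castSucc)))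
      = mulAll D n (Function.update a i.succ (A.left D p (a i.succ))) := by
  induction n with
  | zero => exact i.elim0
  | succ n ih =>
    rw [mulAll_succ, mulAll_succ]
    refine Fin.cases ?_ (fun j => ?_) i
    · have h := mulAll_left n p (Fin.tail a)
      simp only [Fin.castSucc_zero, Fin.tail_update_zero, Function.update_self, A.right_mul, ← h]
      rw [Fin.tail_update_succ]
      simp [Fin.tail]
    · have h := ih (Fin.tail a) j
      rw [← Fin.succ_castSucc, Fin.tail_update_succ, Fin.tail_update_succ]
      rw [Function.update_of_ne (Fin.succ_ne_zero _).symm,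
        Function.update_of_ne (Fin.succ_ne_zero _).symm]
      exact congrArg (a 0 * ·) h

/-- `h₀ ⊗ ⋯ ⊗ hₙ ↦ ((a₀, ..., aₙ) ↦ h₀(a₀) ⋯ hₙ(aₙ))`, on the tensor power over `ℂ`. -/
def chiTensor (D : Datum) (n : ℕ) :
    (⨂[ℂ] _ : Fin (n + 1), Hs) →ₗ[ℂ] MultilinearMap ℂ (fun _ : Fin (n + 1) => A D) (A D) :=
  PiTensorProduct.lift
    (((LinearMap.applyₗ (mulAll D n)).compMultilinearMap
      MultilinearMap.compLinearMapMultilinear).compLinearMap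
        fun _ : Fin (n + 1) => (chiOne D).toLinearMap)

theorem chiTensor_tprod (D : Datum) (n : ℕ) (h : Fin (n + 1) → Hs) (a : Fin (n + 1) → A D) :
    chiTensor D n (PiTensorProduct.tprod ℂ h) a = mulAll D n fun i => chiOne D (h i) (a i) := by
  rw [chiTensor, PiTensorProduct.lift.tprod]
  rfl

theorem balanced_le_ker (D : Datum) (n : ℕ) : balanced n ≤ LinearMap.ker (chiTensor D n) := by
  rw [balanced, Submodule.span_le]
  rintro _ ⟨h, i, p, rfl⟩
  rw [SetLike.mem_coe, LinearMap.mem_ker, map_sub, sub_eq_zero]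
  ext a
  rw [chiTensor_tprod, chiTensor_tprod]
  have e : ∀ (j : Fin (n + 1)) (g : Gen),
      (fun i => chiOne D (Function.update h j (Hs.gen g * h j) i) (a i))
        = Function.update (fun i => chiOne D (h i) (a i)) j
            (genAction D g (chiOne D (h j) (a j))) := by
    intro j g
    ext k
    rcases eq_or_ne k j with rfl | hk
    · simp [chiOne_gen]
    · simp [hk]
  rw [e, e]
  exact mulAll_balanced n p _ i

/-- The action of `Hs ⊗_P ⋯ ⊗_P Hs` (`n + 1` factors) by multilinear maps,
`h₀ ⊗ ⋯ ⊗ hₙ ↦ ((a₀, ..., aₙ) ↦ h₀(a₀) ⋯ hₙ(aₙ))`. -/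
def chi (D : Datum) (n : ℕ) :
    HsTensor n →ₗ[ℂ] MultilinearMap ℂ (fun _ : Fin (n + 1) => A D) (A D) :=
  Submodule.liftQ (balanced n) (chiTensor D n) (balanced_le_ker D n)

end

end FoliationHopf

end

/-!
The proof compares a spanning set of the tensor power of `Hs` over `P` with a family of linearly
independent functionals on it.

*Spanning.* In `Hs` the elements `δ_n`, `n ≥ 2`, are expressed through `X`, `δ_1`, `α(Z 0)` and
`β(Z 0)`, and the commutation rules allow every word to be ordered, so `Hs` is spanned by the
products `α(Z ^ μ) β(Z ^ μ') δ_1 ^ k X ^ a Y ^ b` (`Hs.ordered_span_eq_top`). In the tensor power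
each `β` can be moved into the next factor, where it becomes an `α`; hence the tensor power is
spanned by elements `basicTensor j` that contain `n + 2` monomials of `P` and `n + 1` triples of
exponents `(k, a, b)` (`basicTensor_span_eq_top`). Their independence is not needed in advance: it
is a consequence of the argument below.

*Separation.* The lift of `φ` preserves the connection as soon as
`S(φ) + ν = (φ')² (ν ∘ φ)`, `S` being the Schwarzian derivative (`IsProjective.preserves`), and the
solutions of this equation form a pseudogroup by the chain rule for `S`. It is an ordinary
differential equation of third order for `φ`, so that for an arbitrary smooth `ν` there are
solutions with prescribed `φ(x)` and `φ''(x)`, and `φ'(x) = 1`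
(`exists_mem_projectiveGroupoid`). Choose solutions `φ_i` with `φ_i(i) = i + 1`, `i = 0, ..., n`,
and monomials `f_i U_{φ_i⁻¹}` for which `f_i` is `exp (s_i (x - i)) y ^ {m_i}` near the point
`(i, 1)`. Evaluated at `(0, 1)`, the product of the factors of `basicTensor j` applied to these
monomials is a product over the orbit `(0, 1), ..., (n + 1, 1)`: `Z k` gives `-ν^{(k)}(i)`, `δ_1`
gives `φ_i''(i)`, `X` gives `s_i` and `Y` gives `m_i` (`exists_evaluation`). All these numbers can
be prescribed independently, and different `j` give different monomials in them. So a combination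
of the `basicTensor j` in the common kernel yields a polynomial that vanishes at all points with
natural coordinates, hence is zero (`eq_zero_of_forall_chi`).
-/

noncomputable section

namespace FoliationHopf

open MvPolynomial (monomial)

/-! ### Ordered monomials span the quotient algebra -/

namespace Hs

/-- The projection from the free algebra. -/
def ofFree : FreeAlgebra ℂ Gen →ₐ[ℂ] Hs :=
  (RingQuot.mkAlgHom ℂ RelS).comp (RingQuot.mkAlgHom ℂ Rel1)

theorem ofFree_ι (g : Gen) : ofFree (FreeAlgebra.ι ℂ g) = gen g := rfl

theorem ofFree_surjective : Function.Surjective ofFree :=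
  (RingQuot.mkAlgHom_surjective ℂ RelS).comp (RingQuot.mkAlgHom_surjective ℂ Rel1)

theorem ofFree_rel {x y : FreeAlgebra ℂ Gen} (h : Rel1 x y) : ofFree x = ofFree y :=
  congrArg (RingQuot.mkAlgHom ℂ RelS) (RingQuot.mkAlgHom_rel ℂ h)

theorem X_delta (n : ℕ) :
    gen .X * gen (.delta n) = gen (.delta n) * gen .X + gen (.delta (n + 1)) := by
  simpa [ofFree_ι] using ofFree_rel (.X_delta n)

theorem Y_X : gen .Y * gen .X = gen .X * gen .Y + gen .X := by
  simpa [ofFree_ι] using ofFree_rel .Y_X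

theorem Y_delta_zero : gen .Y * gen (.delta 0) = gen (.delta 0) * gen .Y + gen (.delta 0) := by
  simpa [ofFree_ι] using ofFree_rel (.Y_delta 0)

theorem alpha_one : gen (.alpha 1) = 1 := by
  have := ofFree_rel (.alpha_const 1)
  rwa [map_one, map_one, map_one] at this

theorem beta_one : gen (.beta 1) = 1 := by
  have := ofFree_rel (.beta_const 1)
  rwa [map_one, map_one, map_one] at this

theorem alpha_add (p q : P) : gen (.alpha (p + q)) = gen (.alpha p) + gen (.alpha q) := by
  simpa [ofFree_ι] using ofFree_rel (.alpha_add p q)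

theorem beta_add (p q : P) : gen (.beta (p + q)) = gen (.beta p) + gen (.beta q) := by
  simpa [ofFree_ι] using ofFree_rel (.beta_add p q)

theorem alpha_mul (p q : P) : gen (.alpha (p * q)) = gen (.alpha p) * gen (.alpha q) := by
  simpa [ofFree_ι] using ofFree_rel (.alpha_mul p q)

theorem beta_mul (p q : P) : gen (.beta (p * q)) = gen (.beta p) * gen (.beta q) := by
  simpa [ofFree_ι] using ofFree_rel (.beta_mul p q)

theorem alpha_const (c : ℂ) : gen (.alpha (MvPolynomial.C c)) = algebraMap ℂ Hs c := by
  have := ofFree_rel (.alpha_const c)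
  rwa [AlgHom.commutes] at this

theorem beta_const (c : ℂ) : gen (.beta (MvPolynomial.C c)) = algebraMap ℂ Hs c := by
  have := ofFree_rel (.beta_const c)
  rwa [AlgHom.commutes] at this

theorem alpha_beta (p q : P) : gen (.alpha p) * gen (.beta q) = gen (.beta q) * gen (.alpha p) := by
  simpa [ofFree_ι] using ofFree_rel (.alpha_beta p q)

theorem X_alpha (p : P) :
    gen .X * gen (.alpha p) = gen (.alpha p) * gen .X + gen (.alpha (dX p)) := by
  simpa [ofFree_ι] using ofFree_rel (.X_alpha p)

theorem Y_alpha (p : P) :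
    gen .Y * gen (.alpha p) = gen (.alpha p) * gen .Y + gen (.alpha (dY p)) := by
  simpa [ofFree_ι] using ofFree_rel (.Y_alpha p)

theorem X_beta (q : P) : gen .X * gen (.beta q)
    = gen (.beta q) * gen .X + (gen (.beta (dX q)) + gen (.beta (dY q)) * gen (.delta 0)) := by
  simpa [ofFree_ι, add_assoc] using ofFree_rel (.X_beta q)

theorem Y_beta (q : P) :
    gen .Y * gen (.beta q) = gen (.beta q) * gen .Y + gen (.beta (dY q)) := by
  simpa [ofFree_ι] using ofFree_rel (.Y_beta q)

theorem delta_alpha (n : ℕ) (p : P) :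
    gen (.delta n) * gen (.alpha p) = gen (.alpha p) * gen (.delta n) := by
  simpa [ofFree_ι] using ofFree_rel (.delta_alpha n p)

theorem delta_beta (n : ℕ) (p : P) :
    gen (.delta n) * gen (.beta p) = gen (.beta p) * gen (.delta n) := by
  simpa [ofFree_ι] using ofFree_rel (.delta_beta n p)

theorem delta_one : gen (.delta 1) = (1 / 2 : ℂ) • (gen (.delta 0) * gen (.delta 0))
    + gen (.alpha (MvPolynomial.X 0)) - gen (.beta (MvPolynomial.X 0)) := by
  have h := RingQuot.mkAlgHom_rel ℂ RelS.delta2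
  rw [map_zero, map_add, map_sub, map_sub, map_smul, map_pow, pow_two] at h
  change gen (.delta 1) - (1 / 2 : ℂ) • (gen (.delta 0) * gen (.delta 0))
    - gen (.alpha (MvPolynomial.X 0)) + gen (.beta (MvPolynomial.X 0)) = 0 at h
  rw [← sub_eq_zero, ← h]
  abel

/-- The element `δ_1 ^ e₀ X ^ e₁ Y ^ e₂`. -/
def word (e : Fin 3 → ℕ) : Hs := gen (.delta 0) ^ e 0 * (gen .X ^ e 1 * gen .Y ^ e 2)

/-- The ordered monomial `α(Z ^ μ) β(Z ^ μ') δ_1 ^ e₀ X ^ e₁ Y ^ e₂`. -/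
def ordered (μ μ' : ℕ →₀ ℕ) (e : Fin 3 → ℕ) : Hs :=
  gen (.alpha (monomial μ 1)) * (gen (.beta (monomial μ' 1)) * word e)

/-- The subspace spanned by the products `α(p) β(q) δ_1 ^ k`. -/
def coeffs : Submodule ℂ Hs :=
  Submodule.span ℂ {c | ∃ p q k, c = gen (.alpha p) * (gen (.beta q) * gen (.delta 0) ^ k)}

theorem mul_mem_coeffs {u : Hs}
    (hu : ∀ p q k, u * (gen (.alpha p) * (gen (.beta q) * gen (.delta 0) ^ k)) ∈ coeffs)
    {c : Hs} (hc : c ∈ coeffs) : u * c ∈ coeffs := by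
  induction hc using Submodule.span_induction with
  | mem c h => obtain ⟨p, q, k, rfl⟩ := h; exact hu p q k
  | zero => rw [mul_zero]; exact zero_mem _
  | add a b _ _ ha hb => rw [mul_add]; exact add_mem ha hb
  | smul r a _ ha => rw [mul_smul_comm]; exact Submodule.smul_mem _ _ ha

theorem alpha_mul_mem (p : P) {c : Hs} (hc : c ∈ coeffs) : gen (.alpha p) * c ∈ coeffs :=
  mul_mem_coeffs (fun p' q k => Submodule.subset_span ⟨p * p', q, k, by
    rw [alpha_mul, mul_assoc]⟩) hc

theorem beta_mul_mem (q : P) {c : Hs} (hc : c ∈ coeffs) : gen (.beta q) * c ∈ coeffs :=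
  mul_mem_coeffs (fun p q' k => Submodule.subset_span ⟨p, q * q', k, by
    rw [beta_mul, ← mul_assoc, ← alpha_beta]; simp only [mul_assoc]⟩) hc

theorem delta_mul_mem {c : Hs} (hc : c ∈ coeffs) : gen (.delta 0) * c ∈ coeffs :=
  mul_mem_coeffs (fun p q k => Submodule.subset_span ⟨p, q, k + 1, by
    rw [pow_succ', ← mul_assoc, delta_alpha, mul_assoc, ← mul_assoc _ (gen (.beta q)), delta_beta,
      mul_assoc]⟩) hc

theorem one_mem_coeffs : (1 : Hs) ∈ coeffs :=
  Submodule.subset_span ⟨1, 1, 0, by rw [alpha_one, beta_one, pow_zero, mul_one, mul_one]⟩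

/-- If `u w = w u + d`, then `[u, w c] = d c + w [u, c]`. -/
theorem commutator_mul {u w d c : Hs} (h : u * w = w * u + d) :
    u * (w * c) - w * c * u = d * c + w * (u * c - c * u) := by
  rw [← mul_assoc, h]
  noncomm_ring

/-- The operator `[u, ·]` preserves `coeffs` if it does so after left multiplication by each of the
generators `α(p)`, `β(p)`, `δ_1`. -/
theorem commutator_mem_coeffs {u : Hs}
    (hα : ∀ p, ∀ c ∈ coeffs, u * c - c * u ∈ coeffs →
      u * (gen (.alpha p) * c) - gen (.alpha p) * c * u ∈ coeffs)
    (hβ : ∀ p, ∀ c ∈ coeffs, u * c - c * u ∈ coeffs →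
      u * (gen (.beta p) * c) - gen (.beta p) * c * u ∈ coeffs)
    (hδ : ∀ c ∈ coeffs, u * c - c * u ∈ coeffs →
      u * (gen (.delta 0) * c) - gen (.delta 0) * c * u ∈ coeffs)
    {c : Hs} (hc : c ∈ coeffs) : u * c - c * u ∈ coeffs := by
  induction hc using Submodule.span_induction with
  | mem c h =>
    obtain ⟨p, q, k, rfl⟩ := h
    have hk : gen (.delta 0) ^ k ∈ coeffs
        ∧ u * gen (.delta 0) ^ k - gen (.delta 0) ^ k * u ∈ coeffs := by
      induction k with
      | zero =>
        rw [pow_zero, mul_one, one_mul, sub_self]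
        exact ⟨one_mem_coeffs, zero_mem _⟩
      | succ k ih =>
        rw [pow_succ']
        exact ⟨delta_mul_mem ih.1, hδ _ ih.1 ih.2⟩
    exact hα _ _ (beta_mul_mem _ hk.1) (hβ _ _ hk.1 hk.2)
  | zero => rw [mul_zero, zero_mul, sub_zero]; exact zero_mem _
  | add a b _ _ ha hb =>
    have : u * (a + b) - (a + b) * u = (u * a - a * u) + (u * b - b * u) := by noncomm_ring
    rw [this]; exact add_mem ha hb
  | smul r a _ ha =>
    rw [mul_smul_comm, smul_mul_assoc, ← smul_sub]; exact Submodule.smul_mem _ _ ha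

theorem X_commutator_mem {c : Hs} (hc : c ∈ coeffs) : gen .X * c - c * gen .X ∈ coeffs := by
  refine commutator_mem_coeffs (fun p c hc h => ?_) (fun p c hc h => ?_) (fun c hc h => ?_) hc
  · rw [commutator_mul (X_alpha p)]
    exact add_mem (alpha_mul_mem _ hc) (alpha_mul_mem _ h)
  · rw [commutator_mul (X_beta p), add_mul, mul_assoc]
    exact add_mem (add_mem (beta_mul_mem _ hc) (beta_mul_mem _ (delta_mul_mem hc)))
      (beta_mul_mem _ h)
  · rw [commutator_mul (X_delta 0), zero_add, delta_one, sub_mul, add_mul, smul_mul_assoc,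
      mul_assoc]
    exact add_mem (sub_mem (add_mem (Submodule.smul_mem _ _ (delta_mul_mem (delta_mul_mem hc)))
      (alpha_mul_mem _ hc)) (beta_mul_mem _ hc)) (delta_mul_mem h)

theorem Y_commutator_mem {c : Hs} (hc : c ∈ coeffs) : gen .Y * c - c * gen .Y ∈ coeffs := by
  refine commutator_mem_coeffs (fun p c hc h => ?_) (fun p c hc h => ?_) (fun c hc h => ?_) hc
  · rw [commutator_mul (Y_alpha p)]
    exact add_mem (alpha_mul_mem _ hc) (alpha_mul_mem _ h)
  · rw [commutator_mul (Y_beta p)]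
    exact add_mem (beta_mul_mem _ hc) (beta_mul_mem _ h)
  · rw [commutator_mul Y_delta_zero]
    exact add_mem (delta_mul_mem hc) (delta_mul_mem h)

/-- The subspace spanned by the products `c X ^ a Y ^ b` with `c` a combination of products
`α(p) β(q) δ_1 ^ k`. -/
def normal : Submodule ℂ Hs :=
  Submodule.span ℂ {h | ∃ c ∈ coeffs, ∃ a b, h = c * (gen .X ^ a * gen .Y ^ b)}

theorem mul_mem_normal {u : Hs}
    (hu : ∀ c ∈ coeffs, ∀ a b, u * (c * (gen .X ^ a * gen .Y ^ b)) ∈ normal)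
    {h : Hs} (hh : h ∈ normal) : u * h ∈ normal := by
  induction hh using Submodule.span_induction with
  | mem c h => obtain ⟨c, hc, a, b, rfl⟩ := h; exact hu c hc a b
  | zero => rw [mul_zero]; exact zero_mem _
  | add a b _ _ ha hb => rw [mul_add]; exact add_mem ha hb
  | smul r a _ ha => rw [mul_smul_comm]; exact Submodule.smul_mem _ _ ha

theorem mem_normal {c : Hs} (hc : c ∈ coeffs) (a b : ℕ) :
    c * (gen .X ^ a * gen .Y ^ b) ∈ normal := Submodule.subset_span ⟨c, hc, a, b, rfl⟩

theorem X_mul_mem {h : Hs} (hh : h ∈ normal) : gen .X * h ∈ normal := by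
  refine mul_mem_normal (fun c hc a b => ?_) hh
  have : gen .X * (c * (gen .X ^ a * gen .Y ^ b))
      = c * (gen .X ^ (a + 1) * gen .Y ^ b)
        + (gen .X * c - c * gen .X) * (gen .X ^ a * gen .Y ^ b) := by
    rw [pow_succ']; noncomm_ring
  rw [this]
  exact add_mem (mem_normal hc _ _) (mem_normal (X_commutator_mem hc) _ _)

theorem Y_mul_X_pow (a : ℕ) :
    gen .Y * gen .X ^ a = gen .X ^ a * gen .Y + (a : ℂ) • gen .X ^ a := by
  induction a with
  | zero => simp
  | succ a ih =>
    rw [pow_succ, ← mul_assoc, ih, add_mul, mul_assoc, Y_X, smul_mul_assoc]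
    push_cast
    rw [mul_add, mul_assoc]
    module

theorem Y_mul_mem {h : Hs} (hh : h ∈ normal) : gen .Y * h ∈ normal := by
  refine mul_mem_normal (fun c hc a b => ?_) hh
  have : gen .Y * (c * (gen .X ^ a * gen .Y ^ b))
      = c * ((gen .Y * gen .X ^ a) * gen .Y ^ b)
        + (gen .Y * c - c * gen .Y) * (gen .X ^ a * gen .Y ^ b) := by
    noncomm_ring
  rw [this, Y_mul_X_pow, add_mul, mul_assoc, ← pow_succ', smul_mul_assoc, mul_add, mul_smul_comm]
  exact add_mem (add_mem (mem_normal hc _ _) (Submodule.smul_mem _ _ (mem_normal hc _ _)))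
    (mem_normal (Y_commutator_mem hc) _ _)

theorem gen_mul_mem (g : Gen) {h : Hs} (hh : h ∈ normal) : gen g * h ∈ normal := by
  cases g with
  | X => exact X_mul_mem hh
  | Y => exact Y_mul_mem hh
  | alpha p =>
    refine mul_mem_normal (fun c hc a b => ?_) hh
    rw [← mul_assoc]; exact mem_normal (alpha_mul_mem p hc) a b
  | beta p =>
    refine mul_mem_normal (fun c hc a b => ?_) hh
    rw [← mul_assoc]; exact mem_normal (beta_mul_mem p hc) a b
  | delta n =>
    induction n generalizing h with
    | zero =>
      refine mul_mem_normal (fun c hc a b => ?_) hh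
      rw [← mul_assoc]; exact mem_normal (delta_mul_mem hc) a b
    | succ n ih =>
      -- `δ_{n+2} = [X, δ_{n+1}]`
      have : gen (.delta (n + 1)) * h
          = gen .X * (gen (.delta n) * h) - gen (.delta n) * (gen .X * h) := by
        rw [← mul_assoc, ← mul_assoc, X_delta]; noncomm_ring
      rw [this]
      exact sub_mem (X_mul_mem (ih hh)) (ih (X_mul_mem hh))

/-- `normal` contains `1` and is a left ideal. -/
theorem normal_eq_top : normal = ⊤ := by
  have key : ∀ x : FreeAlgebra ℂ Gen, ∀ h ∈ normal, ofFree x * h ∈ normal := by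
    intro x
    induction x using FreeAlgebra.induction with
    | grade0 r =>
      intro h hh
      rw [AlgHom.commutes, ← Algebra.smul_def]
      exact Submodule.smul_mem _ _ hh
    | grade1 g => exact fun h hh => gen_mul_mem g hh
    | mul a b ha hb =>
      intro h hh
      rw [map_mul, mul_assoc]
      exact ha _ (hb _ hh)
    | add a b ha hb =>
      intro h hh
      rw [map_add, add_mul]
      exact add_mem (ha _ hh) (hb _ hh)
  refine (Submodule.eq_top_iff').2 fun h => ?_
  obtain ⟨x, rfl⟩ := ofFree_surjective h
  have h1 : (1 : Hs) ∈ normal := by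
    simpa using mem_normal one_mem_coeffs 0 0
  simpa using key x 1 h1

/-- The left copy of `P`, as a linear map. -/
def alphaHom : P →ₗ[ℂ] Hs where
  toFun p := gen (.alpha p)
  map_add' := alpha_add
  map_smul' c p := by
    rw [MvPolynomial.smul_eq_C_mul, alpha_mul, alpha_const, ← Algebra.smul_def, RingHom.id_apply]

/-- The right copy of `P`, as a linear map. -/
def betaHom : P →ₗ[ℂ] Hs where
  toFun p := gen (.beta p)
  map_add' := beta_add
  map_smul' c p := by
    rw [MvPolynomial.smul_eq_C_mul, beta_mul, beta_const, ← Algebra.smul_def, RingHom.id_apply]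

theorem ordered_span_eq_top :
    Submodule.span ℂ {h | ∃ μ μ' e, h = ordered μ μ' e} = ⊤ := by
  rw [eq_top_iff, ← normal_eq_top, normal, Submodule.span_le]
  rintro _ ⟨c, hc, a, b, rfl⟩
  rw [SetLike.mem_coe]
  induction hc using Submodule.span_induction with
  | zero => rw [zero_mul]; exact zero_mem _
  | add a b _ _ ha hb => rw [add_mul]; exact add_mem ha hb
  | smul r a _ ha => rw [smul_mul_assoc]; exact Submodule.smul_mem _ _ ha
  | mem c h =>
    obtain ⟨p, q, k, rfl⟩ := h
    change alphaHom p * (betaHom q * gen (.delta 0) ^ k) * (gen .X ^ a * gen .Y ^ b) ∈ _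
    rw [p.as_sum, q.as_sum]
    simp only [map_sum, Finset.sum_mul, Finset.mul_sum]
    refine sum_mem fun μ' _ => sum_mem fun μ _ => ?_
    have e : ∀ (f : P →ₗ[ℂ] Hs) (μ : ℕ →₀ ℕ) (r : ℂ),
        f (monomial μ r) = r • f (monomial μ 1) := fun f μ r => by
      rw [← map_smul, MvPolynomial.smul_monomial, smul_eq_mul, mul_one]
    rw [e alphaHom, e betaHom]
    simp only [smul_mul_assoc, mul_smul_comm]
    refine Submodule.smul_mem _ _ (Submodule.smul_mem _ _ (Submodule.subset_span ?_))
    exact ⟨μ, μ', ![k, a, b], by simp [ordered, word, alphaHom, betaHom, mul_assoc]⟩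

end Hs

/-! ### Ordered monomials span the tensor powers -/

/-- A multilinear map that sends tuples from a spanning set into a subspace has all its values
there. -/
theorem _root_.MultilinearMap.mem_of_span_eq_top {R ι M N : Type*} [CommRing R] [Finite ι]
    [AddCommGroup M] [Module R M] [AddCommGroup N] [Module R N]
    (f : MultilinearMap R (fun _ : ι => M) N) {S : Set M} (hS : Submodule.span R S = ⊤)
    {W : Submodule R N} (hf : ∀ v : ι → M, (∀ i, v i ∈ S) → f v ∈ W) (v : ι → M) : f v ∈ W := by
  classical
  have := Fintype.ofFinite ι
  have key : ∀ s : Finset ι, ∀ v : ι → M, (∀ i ∉ s, v i ∈ S) → f v ∈ W := by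
    intro s
    induction s using Finset.induction_on with
    | empty => exact fun v hv => hf v fun i => hv i (Finset.notMem_empty i)
    | insert j s hj ih =>
      intro v hv
      have : ∀ m ∈ Submodule.span R S, f (Function.update v j m) ∈ W := by
        intro m hm
        induction hm using Submodule.span_induction with
        | mem m hm =>
          refine ih _ fun i hi => ?_
          rcases eq_or_ne i j with rfl | hij
          · rwa [Function.update_self]
          · rw [Function.update_of_ne hij]
            exact hv i (by simp [hij, hi])
        | zero => rw [f.map_update_zero]; exact zero_mem _
        | add a b _ _ ha hb => rw [f.map_update_add]; exact add_mem ha hb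
        | smul r a _ ha => rw [f.map_update_smul]; exact W.smul_mem _ ha
      have h := this (v j) (hS ▸ Submodule.mem_top)
      rwa [Function.update_eq_self] at h
  exact key Finset.univ v fun i hi => absurd (Finset.mem_univ i) hi

/-- The multilinear map `(h₀, ..., hₙ) ↦ h₀ ⊗ ⋯ ⊗ hₙ` into the tensor power over `P`. -/
def tensor (n : ℕ) : MultilinearMap ℂ (fun _ : Fin (n + 1) => Hs) (HsTensor n) :=
  (balanced n).mkQ.compMultilinearMap (PiTensorProduct.tprod ℂ)

theorem tensor_apply (n : ℕ) (h : Fin (n + 1) → Hs) :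
    tensor n h = (balanced n).mkQ (PiTensorProduct.tprod ℂ h) := rfl

theorem tensor_balanced {n : ℕ} (h : Fin (n + 1) → Hs) (i : Fin n) (p : P) :
    tensor n (Function.update h i.castSucc (Hs.gen (.beta p) * h i.castSucc))
      = tensor n (Function.update h i.succ (Hs.gen (.alpha p) * h i.succ)) := by
  rw [← sub_eq_zero, tensor_apply, tensor_apply, ← map_sub]
  exact (Submodule.Quotient.mk_eq_zero _).2 (Submodule.subset_span ⟨h, i, p, rfl⟩)

theorem monomial_zero_one : (monomial (0 : ℕ →₀ ℕ) (1 : ℂ)) = 1 := rfl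

theorem Hs.beta_mul_ordered (μ ν : ℕ →₀ ℕ) (e : Fin 3 → ℕ) :
    gen (.beta (monomial ν 1)) * ordered μ 0 e = ordered μ ν e := by
  rw [ordered, monomial_zero_one, beta_one, one_mul, ← mul_assoc, ← alpha_beta, mul_assoc, ordered]

theorem Hs.alpha_mul_ordered (μ ν κ : ℕ →₀ ℕ) (e : Fin 3 → ℕ) :
    gen (.alpha (monomial κ 1)) * ordered μ ν e = ordered (κ + μ) ν e := by
  rw [ordered, ← mul_assoc, ← alpha_mul, MvPolynomial.monomial_mul, mul_one, ordered]

/-- The tensor product of the ordered monomials with exponents `μ`, `μ'`, `e`. -/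
def orderedTensor {n : ℕ} (μ μ' : Fin (n + 1) → ℕ →₀ ℕ) (e : Fin (n + 1) → Fin 3 → ℕ) :
    HsTensor n := tensor n fun i => Hs.ordered (μ i) (μ' i) (e i)

/-- A factor `β(Z ^ μ')` moves to the next tensor factor, where it becomes `α(Z ^ μ')`. -/
theorem orderedTensor_move {n : ℕ} (μ μ' : Fin (n + 1) → ℕ →₀ ℕ) (e : Fin (n + 1) → Fin 3 → ℕ)
    (i : Fin n) : orderedTensor μ μ' e
      = orderedTensor (Function.update μ i.succ (μ' i.castSucc + μ i.succ))
          (Function.update μ' i.castSucc 0) e := by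
  have h := tensor_balanced
    (fun l => Hs.ordered (μ l) (Function.update μ' i.castSucc 0 l) (e l)) i
    (monomial (μ' i.castSucc) 1)
  simp only [Function.update_self, Hs.beta_mul_ordered, Hs.alpha_mul_ordered] at h
  refine Eq.trans ?_ (h.trans ?_)
  · refine congrArg (tensor n) (funext fun l => ?_)
    rcases eq_or_ne l i.castSucc with rfl | hl
    · simp
    · simp [hl]
  · refine congrArg (tensor n) (funext fun l => ?_)
    rcases eq_or_ne l i.succ with rfl | hl
    · simp
    · simp [hl]

/-- Exponents of an ordered monomial in the `(n + 1)`-fold tensor power: one monomial of `P` for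
each of the `n + 2` places to the left of, between and to the right of the tensor factors, and the
exponents of `δ_1`, `X`, `Y` in each factor. -/
abbrev Exponents (n : ℕ) : Type := (Fin (n + 2) → ℕ →₀ ℕ) × (Fin (n + 1) → Fin 3 → ℕ)

/-- The exponents of the right copy of `P` in an ordered monomial in the tensor power: only the
last factor contains `β`. -/
def Exponents.right {n : ℕ} (j : Exponents n) (i : Fin (n + 1)) : ℕ →₀ ℕ :=
  if i = Fin.last n then j.1 (Fin.last (n + 1)) else 0

/-- The ordered monomial with given exponents. -/
def basicTensor {n : ℕ} (j : Exponents n) : HsTensor n :=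
  orderedTensor (fun i => j.1 i.castSucc) j.right j.2

theorem orderedTensor_mem_span {n : ℕ} (μ μ' : Fin (n + 1) → ℕ →₀ ℕ)
    (e : Fin (n + 1) → Fin 3 → ℕ) :
    orderedTensor μ μ' e ∈ Submodule.span ℂ (Set.range (basicTensor (n := n))) := by
  -- Downward induction on the number `k` of leading factors without `β`.
  have key : ∀ k ≤ n, ∀ μ μ' : Fin (n + 1) → ℕ →₀ ℕ, (∀ i : Fin (n + 1), i.val < k → μ' i = 0) →
      orderedTensor μ μ' e ∈ Submodule.span ℂ (Set.range (basicTensor (n := n))) := by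
    intro k hk
    induction hk using Nat.decreasingInduction with
    | self =>
      intro μ μ' h
      refine Submodule.subset_span ⟨(Fin.snoc μ (μ' (Fin.last n)), e), ?_⟩
      rw [basicTensor]
      congr 1
      · funext i; simp
      · funext i
        rw [Exponents.right]
        split_ifs with hi
        · simp [hi]
        · exact (h i (Fin.val_lt_last hi)).symm
    | of_succ k hk ih =>
      intro μ μ' h
      rw [orderedTensor_move μ μ' e ⟨k, hk⟩]
      refine ih _ _ fun i hi => ?_
      rcases eq_or_ne i (Fin.castSucc ⟨k, hk⟩) with rfl | hik
      · simp
      · rw [Function.update_of_ne hik]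
        have : i.val ≠ k := fun h => hik (Fin.ext h)
        exact h i (by omega)
  exact key 0 (Nat.zero_le n) μ μ' fun i hi => absurd hi (Nat.not_lt_zero _)

theorem basicTensor_span_eq_top (n : ℕ) :
    Submodule.span ℂ (Set.range (basicTensor (n := n))) = ⊤ := by
  rw [Submodule.eq_top_iff']
  intro t
  obtain ⟨t, rfl⟩ := (balanced n).mkQ_surjective t
  induction t using PiTensorProduct.induction_on with
  | add a b ha hb => rw [map_add]; exact add_mem ha hb
  | smul_tprod r h =>
    rw [map_smul, ← tensor_apply]
    refine Submodule.smul_mem _ _ ((tensor n).mem_of_span_eq_top Hs.ordered_span_eq_top ?_ h)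
    intro v hv
    choose μ μ' e hv using hv
    rw [funext hv]
    exact orderedTensor_mem_span μ μ' e

/-! ### The pseudogroup of all compatible diffeomorphisms -/

/-- The logarithmic derivative `φ'' / φ'` of `φ'`. -/
def preSchwarzian (φ : ℝ → ℝ) (x : ℝ) : ℝ := deriv (deriv φ) x / deriv φ x

/-- The defect `S(φ) + ν - (φ')² (ν ∘ φ)` of invariance of the projective structure `ν` under `φ`,
where `S(φ) = (φ'' / φ')' - (φ'' / φ')² / 2` is the Schwarzian derivative. -/
def defect (ν φ : ℝ → ℝ) (x : ℝ) : ℝ :=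
  deriv (preSchwarzian φ) x - 1 / 2 * preSchwarzian φ x ^ 2 + ν x - deriv φ x ^ 2 * ν (φ x)

/-- On `u`, the map `f` is smooth, orientation preserving and preserves the projective
structure `ν`. -/
structure IsProjective (ν f : ℝ → ℝ) (u : Set ℝ) : Prop where
  smooth : ContDiffOn ℝ ∞ f u
  deriv_pos : ∀ x ∈ u, 0 < deriv f x
  defect_eq_zero : ∀ x ∈ u, defect ν f x = 0

theorem _root_.ContDiffOn.deriv_isOpen {f : ℝ → ℝ} {u : Set ℝ} (hf : ContDiffOn ℝ ∞ f u)
    (hu : IsOpen u) : ContDiffOn ℝ ∞ (deriv f) u :=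
  ((contDiffOn_infty_iff_deriv_of_isOpen hu).1 hf).2

theorem _root_.ContDiffOn.hasDerivAt_isOpen {f : ℝ → ℝ} {u : Set ℝ} (hf : ContDiffOn ℝ ∞ f u)
    (hu : IsOpen u) {x : ℝ} (hx : x ∈ u) : HasDerivAt f (deriv f x) x :=
  ((hf.contDiffAt (hu.mem_nhds hx)).differentiableAt (by simp)).hasDerivAt

theorem contDiffOn_preSchwarzian {f : ℝ → ℝ} {u : Set ℝ} (hf : ContDiffOn ℝ ∞ f u)
    (hu : IsOpen u) (h0 : ∀ x ∈ u, deriv f x ≠ 0) : ContDiffOn ℝ ∞ (preSchwarzian f) u :=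
  ((hf.deriv_isOpen hu).deriv_isOpen hu).div (hf.deriv_isOpen hu) h0

theorem preSchwarzian_comp {f g : ℝ → ℝ} {u v : Set ℝ} (hf : ContDiffOn ℝ ∞ f u)
    (hg : ContDiffOn ℝ ∞ g v) (hu : IsOpen u) (hv : IsOpen v) (huv : IsOpen (u ∩ f ⁻¹' v))
    (hf0 : ∀ x ∈ u, deriv f x ≠ 0) (hg0 : ∀ x ∈ v, deriv g x ≠ 0) {x : ℝ}
    (hx : x ∈ u ∩ f ⁻¹' v) :
    preSchwarzian (g ∘ f) x = deriv f x * preSchwarzian g (f x) + preSchwarzian f x := by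
  have h1 : ∀ y ∈ u ∩ f ⁻¹' v, deriv (g ∘ f) y = deriv g (f y) * deriv f y := fun y hy =>
    ((hg.hasDerivAt_isOpen hv hy.2).comp y (hf.hasDerivAt_isOpen hu hy.1)).deriv
  have h2 : HasDerivAt (fun y => deriv g (f y) * deriv f y) _ x :=
    (((hg.deriv_isOpen hv).hasDerivAt_isOpen hv hx.2).comp x
      (hf.hasDerivAt_isOpen hu hx.1)).mul ((hf.deriv_isOpen hu).hasDerivAt_isOpen hu hx.1)
  have h3 : deriv (g ∘ f) =ᶠ[𝓝 x] fun y => deriv g (f y) * deriv f y :=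
    Filter.eventually_of_mem (huv.mem_nhds hx) h1
  rw [preSchwarzian, h1 x hx, h3.deriv_eq, h2.deriv]
  have := hf0 x hx.1
  have := hg0 _ hx.2
  simp only [preSchwarzian, Function.comp_apply]
  field_simp

/-- The chain rule for the Schwarzian derivative. -/
theorem defect_comp {ν f g : ℝ → ℝ} {u v : Set ℝ} (hf : ContDiffOn ℝ ∞ f u)
    (hg : ContDiffOn ℝ ∞ g v) (hu : IsOpen u) (hv : IsOpen v) (huv : IsOpen (u ∩ f ⁻¹' v))
    (hf0 : ∀ x ∈ u, deriv f x ≠ 0) (hg0 : ∀ x ∈ v, deriv g x ≠ 0) {x : ℝ}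
    (hx : x ∈ u ∩ f ⁻¹' v) :
    defect ν (g ∘ f) x = deriv f x ^ 2 * defect ν g (f x) + defect ν f x := by
  have h1 : deriv (g ∘ f) x = deriv g (f x) * deriv f x :=
    ((hg.hasDerivAt_isOpen hv hx.2).comp x (hf.hasDerivAt_isOpen hu hx.1)).deriv
  have h2 : preSchwarzian (g ∘ f) =ᶠ[𝓝 x]
      fun y => deriv f y * preSchwarzian g (f y) + preSchwarzian f y :=
    Filter.eventually_of_mem (huv.mem_nhds hx)
      fun y hy => preSchwarzian_comp hf hg hu hv huv hf0 hg0 hy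
  have h3 : HasDerivAt (fun y => deriv f y * preSchwarzian g (f y) + preSchwarzian f y) _ x :=
    (((hf.deriv_isOpen hu).hasDerivAt_isOpen hu hx.1).mul
      (((contDiffOn_preSchwarzian hg hv hg0).hasDerivAt_isOpen hv hx.2).comp x
        (hf.hasDerivAt_isOpen hu hx.1))).add
      ((contDiffOn_preSchwarzian hf hu hf0).hasDerivAt_isOpen hu hx.1)
  have h4 : deriv (deriv f) x = preSchwarzian f x * deriv f x :=
    (div_mul_cancel₀ _ (hf0 x hx.1)).symm
  rw [defect, h2.deriv_eq, h3.deriv, h2.eq_of_nhds, h1, h4, defect, defect]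
  simp only [Function.comp_apply]
  ring

theorem defect_congr {ν f g : ℝ → ℝ} {x : ℝ} (h : f =ᶠ[𝓝 x] g) : defect ν f x = defect ν g x := by
  have h2 : preSchwarzian f =ᶠ[𝓝 x] preSchwarzian g := by
    filter_upwards [h.deriv, h.deriv.deriv] with y h1 h2
    rw [preSchwarzian, preSchwarzian, h1, h2]
  rw [defect, defect, h2.deriv_eq, h2.eq_of_nhds, h.deriv_eq, h.eq_of_nhds]

theorem defect_id (ν : ℝ → ℝ) (x : ℝ) : defect ν id x = 0 := by
  have : preSchwarzian id = fun _ => 0 := by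
    funext y
    simp [preSchwarzian, deriv_id']
  simp [defect, this]

namespace IsProjective

variable {ν f g : ℝ → ℝ} {u v : Set ℝ}

theorem mono (h : IsProjective ν f u) (hvu : v ⊆ u) : IsProjective ν f v :=
  ⟨h.smooth.mono hvu, fun x hx => h.deriv_pos x (hvu hx), fun x hx => h.defect_eq_zero x (hvu hx)⟩

theorem comp (hf : IsProjective ν f u) (hg : IsProjective ν g v) (hu : IsOpen u) (hv : IsOpen v)
    (huv : IsOpen (u ∩ f ⁻¹' v)) : IsProjective ν (g ∘ f) (u ∩ f ⁻¹' v) where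
  smooth := hg.smooth.comp (hf.smooth.mono Set.inter_subset_left) Set.inter_subset_right
  deriv_pos x hx := by
    rw [((hg.smooth.hasDerivAt_isOpen hv hx.2).comp x
      (hf.smooth.hasDerivAt_isOpen hu hx.1)).deriv]
    exact mul_pos (hg.deriv_pos _ hx.2) (hf.deriv_pos _ hx.1)
  defect_eq_zero x hx := by
    rw [defect_comp hf.smooth hg.smooth hu hv huv (fun x hx => (hf.deriv_pos x hx).ne')
      (fun x hx => (hg.deriv_pos x hx).ne') hx, hf.defect_eq_zero x hx.1,
      hg.defect_eq_zero _ hx.2, mul_zero, add_zero]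

theorem congr (hu : IsOpen u) (h : ∀ x ∈ u, g x = f x) (hf : IsProjective ν f u) :
    IsProjective ν g u := by
  have he : ∀ x ∈ u, g =ᶠ[𝓝 x] f := fun x hx => Filter.eventually_of_mem (hu.mem_nhds hx) h
  exact ⟨hf.smooth.congr h, fun x hx => (he x hx).deriv_eq ▸ hf.deriv_pos x hx,
    fun x hx => (defect_congr (he x hx)).trans (hf.defect_eq_zero x hx)⟩

theorem of_forall_exists_inter (h : ∀ x ∈ u, ∃ v, IsOpen v ∧ x ∈ v ∧ IsProjective ν f (u ∩ v)) :
    IsProjective ν f u where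
  smooth x hx := by
    obtain ⟨v, hv, hxv, h⟩ := h x hx
    exact (contDiffWithinAt_inter (hv.mem_nhds hxv)).1 (h.smooth x ⟨hx, hxv⟩)
  deriv_pos x hx := by
    obtain ⟨v, hv, hxv, h⟩ := h x hx
    exact h.deriv_pos x ⟨hx, hxv⟩
  defect_eq_zero x hx := by
    obtain ⟨v, hv, hxv, h⟩ := h x hx
    exact h.defect_eq_zero x ⟨hx, hxv⟩

/-- The inverse of a diffeomorphism that preserves `ν` preserves `ν`. -/
theorem symm {φ : OpenPartialHomeomorph ℝ ℝ} (h : IsProjective ν φ φ.source) :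
    IsProjective ν φ.symm φ.target := by
  have hd : ∀ y ∈ φ.target, HasDerivAt φ.symm (deriv φ (φ.symm y))⁻¹ y := fun y hy =>
    φ.hasDerivAt_symm hy (h.deriv_pos _ (φ.map_target hy)).ne'
      (h.smooth.hasDerivAt_isOpen φ.open_source (φ.map_target hy))
  have hs : ContDiffOn ℝ ∞ φ.symm φ.target := fun y hy =>
    (φ.contDiffAt_symm_deriv (h.deriv_pos _ (φ.map_target hy)).ne' hy
      (h.smooth.hasDerivAt_isOpen φ.open_source (φ.map_target hy))
      (h.smooth.contDiffAt (φ.open_source.mem_nhds (φ.map_target hy)))).contDiffWithinAt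
  have hp : ∀ y ∈ φ.target, 0 < deriv φ.symm y := fun y hy => by
    rw [(hd y hy).deriv]
    exact inv_pos.2 (h.deriv_pos _ (φ.map_target hy))
  refine ⟨hs, hp, fun y hy => ?_⟩
  have hx := φ.map_target hy
  have e : φ.source ∩ φ ⁻¹' φ.target = φ.source :=
    Set.inter_eq_left.2 fun x hx => φ.map_source hx
  have hc := defect_comp (ν := ν) h.smooth hs φ.open_source φ.open_target
    (by rw [e]; exact φ.open_source) (fun x hx => (h.deriv_pos x hx).ne')
    (fun y hy => (hp y hy).ne') (x := φ.symm y) (by rw [e]; exact hx)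
  have he : φ.symm ∘ φ =ᶠ[𝓝 (φ.symm y)] id :=
    Filter.eventually_of_mem (φ.open_source.mem_nhds hx) fun x hx => φ.left_inv hx
  rw [defect_congr he, defect_id, h.defect_eq_zero _ hx, add_zero, φ.right_inv hy] at hc
  exact (mul_eq_zero.1 hc.symm).resolve_left (pow_ne_zero 2 (h.deriv_pos _ hx).ne')

end IsProjective

/-- Local maps of `ℝ` preserving the projective structure `ν`. -/
def projectivePregroupoid (ν : ℝ → ℝ) : Pregroupoid ℝ where
  property := IsProjective ν
  comp hf hg hu hv huv := hf.comp hg hu hv huv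
  id_mem := ⟨contDiffOn_id, fun x _ => by simp [deriv_id'], fun x _ => defect_id ν x⟩
  locality _ h := IsProjective.of_forall_exists_inter h
  congr hu h hf := hf.congr hu h

/-- The pseudogroup of all local diffeomorphisms of `ℝ` preserving the projective structure `ν`. -/
def projectiveGroupoid (ν : ℝ → ℝ) : StructureGroupoid ℝ := (projectivePregroupoid ν).groupoid

theorem mem_projectiveGroupoid {ν : ℝ → ℝ} {φ : OpenPartialHomeomorph ℝ ℝ} :
    φ ∈ projectiveGroupoid ν ↔ IsProjective ν φ φ.source := by
  refine mem_groupoid_of_pregroupoid.trans ⟨fun h => h.1, fun h => ⟨h, h.symm⟩⟩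

theorem projectiveGroupoid_restr (ν : ℝ → ℝ) : ClosedUnderRestriction (projectiveGroupoid ν) where
  closedUnderRestriction {e} he s hs := by
    rw [mem_projectiveGroupoid] at he ⊢
    exact he.mono (by rw [e.restr_source]; exact Set.inter_subset_left)

/-! ### Maps preserving the projective structure preserve the connection -/

theorem hasFDerivAt_cotLift {φ : ℝ → ℝ} {u : Set ℝ} (hu : IsOpen u) (hφ : ContDiffOn ℝ ∞ φ u)
    (h0 : ∀ x ∈ u, deriv φ x ≠ 0) {z : ℝ × ℝ} (hz : z.1 ∈ u) :
    DifferentiableAt ℝ (cotLift φ) z ∧ ∀ v : ℝ × ℝ, fderiv ℝ (cotLift φ) z v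
      = (deriv φ z.1 * v.1, v.2 / deriv φ z.1
          - z.2 * deriv (deriv φ) z.1 * v.1 / (deriv φ z.1) ^ 2) := by
  have h1 : HasFDerivAt (fun z : ℝ × ℝ => φ z.1) _ z :=
    (hφ.hasDerivAt_isOpen hu hz).hasFDerivAt.comp z (hasFDerivAt_fst (𝕜 := ℝ) (p := z))
  have h2 : HasFDerivAt (fun z : ℝ × ℝ => (deriv φ z.1)⁻¹) _ z :=
    (((hφ.deriv_isOpen hu).hasDerivAt_isOpen hu hz).inv (h0 _ hz)).hasFDerivAt.comp z
      (hasFDerivAt_fst (𝕜 := ℝ) (p := z))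
  have h3 : HasFDerivAt (cotLift φ) _ z :=
    h1.prodMk ((hasFDerivAt_snd (𝕜 := ℝ) (p := z)).mul h2)
  refine ⟨h3.differentiableAt, fun v => ?_⟩
  rw [h3.fderiv]
  have := h0 _ hz
  ext
  · simp [mul_comm]
  · simp
    field_simp
    ring

theorem cotLift_cotLift_symm {ν : ℝ → ℝ} {φ : OpenPartialHomeomorph ℝ ℝ}
    (h : IsProjective ν φ φ.source) {z : ℝ × ℝ} (hz : z.1 ∈ φ.source) :
    cotLift φ.symm (cotLift φ z) = z := by
  have h0 := (h.deriv_pos _ hz).ne'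
  have hd := (φ.hasDerivAt_symm (φ.map_source hz) (f' := deriv φ z.1) h0 (by
    rw [φ.left_inv hz]; exact h.smooth.hasDerivAt_isOpen φ.open_source hz)).deriv
  ext
  · exact φ.left_inv hz
  · simp only [cotLift]
    rw [hd, div_div, mul_inv_cancel₀ h0, div_one]

/-- The coefficient of `∂₂` is where the Schwarzian identity enters; the other terms of
`Φ_* (∇_U V) = ∇_{Φ_* U} (Φ_* V)` agree for every lift. -/
theorem IsProjective.preserves {ν : ℝ → ℝ} {φ : OpenPartialHomeomorph ℝ ℝ}
    (h : IsProjective ν φ φ.source) : Preserves (fun z => z.2 * ν z.1) φ := by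
  intro U V hU hV w hw
  have h0 : ∀ x ∈ φ.source, deriv φ x ≠ 0 := fun x hx => (h.deriv_pos x hx).ne'
  have h0' : ∀ y ∈ φ.target, deriv φ.symm y ≠ 0 := fun y hy => (h.symm.deriv_pos y hy).ne'
  have hL := fun z => hasFDerivAt_cotLift φ.open_source h.smooth h0 (z := z)
  set z := cotLift φ.symm w with hz
  have hzs : z ∈ slab φ := ⟨φ.map_target hw.1, div_pos hw.2 (h.symm.deriv_pos _ hw.1)⟩
  have hwz : cotLift φ z = w := cotLift_cotLift_symm (φ := φ.symm) h.symm hw.1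
  -- In the coordinates of the source, the push-forward of `V` is `M`.
  let M : ℝ × ℝ → ℝ × ℝ := fun z => fderiv ℝ (cotLift φ) z (V z)
  let N : ℝ × ℝ → ℝ × ℝ := fun z => (deriv φ z.1 * (V z).1, (V z).2 * (deriv φ z.1)⁻¹
          - z.2 * deriv (deriv φ) z.1 * (V z).1 * ((deriv φ z.1)⁻¹) ^ 2)
  have hMN : M =ᶠ[𝓝 z] N := by
    filter_upwards [(isOpen_slab φ).mem_nhds hzs] with z hz
    simp only [M, N, (hL z hz.1).2]
    ext
    · rfl
    · simp only [div_eq_mul_inv, inv_pow]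
  have hVd : HasFDerivAt V (fderiv ℝ V z) z :=
    ((hV.contDiffAt ((isOpen_slab φ).mem_nhds hzs)).differentiableAt (by simp)).hasFDerivAt
  have hV1 : HasFDerivAt (fun z => (V z).1) _ z := hasFDerivAt_fst.comp z hVd
  have hV2 : HasFDerivAt (fun z => (V z).2) _ z := hasFDerivAt_snd.comp z hVd
  have hA : HasFDerivAt (fun z : ℝ × ℝ => deriv φ z.1) _ z :=
    ((h.smooth.deriv_isOpen φ.open_source).hasDerivAt_isOpen φ.open_source
      hzs.1).hasFDerivAt.comp z (hasFDerivAt_fst (𝕜 := ℝ) (p := z))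
  have hI : HasFDerivAt (fun z : ℝ × ℝ => (deriv φ z.1)⁻¹) _ z :=
    (((h.smooth.deriv_isOpen φ.open_source).hasDerivAt_isOpen φ.open_source
      hzs.1).inv (h0 _ hzs.1)).hasFDerivAt.comp z (hasFDerivAt_fst (𝕜 := ℝ) (p := z))
  have hB : HasFDerivAt (fun z : ℝ × ℝ => deriv (deriv φ) z.1) _ z :=
    (((h.smooth.deriv_isOpen φ.open_source).deriv_isOpen φ.open_source).hasDerivAt_isOpen
      φ.open_source hzs.1).hasFDerivAt.comp z (hasFDerivAt_fst (𝕜 := ℝ) (p := z))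
  have hN : HasFDerivAt N _ z := (hA.mul hV1).prodMk ((hV2.mul hI).sub
    ((((hasFDerivAt_snd (𝕜 := ℝ) (p := z)).mul hB).mul hV1).mul (hI.pow 2)))
  have hP : pushforward φ V = fun w => M (cotLift φ.symm w) := rfl
  have hS := (hasFDerivAt_cotLift φ.open_target h.symm.smooth h0' (z := w) hw.1).1
  have hPd : DifferentiableAt ℝ (pushforward φ V) w := by
    rw [hP]
    exact DifferentiableAt.comp w (hMN.differentiableAt_iff.2 hN.differentiableAt) hS
  have hfd : fderiv ℝ (pushforward φ V) w (pushforward φ U w) = fderiv ℝ N z (U z) := by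
    have e : (fun y => pushforward φ V (cotLift φ y)) =ᶠ[𝓝 z] N := by
      refine Filter.EventuallyEq.trans ?_ hMN
      filter_upwards [(isOpen_slab φ).mem_nhds hzs] with y hy
      simp only [hP, cotLift_cotLift_symm h hy.1]
    rw [← e.fderiv_eq]
    have hc := fderiv_comp (𝕜 := ℝ) z (g := pushforward φ V) (f := cotLift φ) (by rwa [hwz])
      (hL z hzs.1).1
    rw [hwz] at hc
    exact (congrArg (fun T => T (U z)) hc).symm
  have key := h.defect_eq_zero _ hzs.1
  have hp : deriv (preSchwarzian φ) z.1 = (deriv (deriv (deriv φ)) z.1 * deriv φ z.1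
      - deriv (deriv φ) z.1 * deriv (deriv φ) z.1) / deriv φ z.1 ^ 2 :=
    ((((h.smooth.deriv_isOpen φ.open_source).deriv_isOpen φ.open_source).hasDerivAt_isOpen
      φ.open_source hzs.1).div ((h.smooth.deriv_isOpen φ.open_source).hasDerivAt_isOpen
      φ.open_source hzs.1) (h0 _ hzs.1)).deriv
  rw [defect, hp, preSchwarzian] at key
  have hw1 : w.1 = φ z.1 := congrArg Prod.fst hwz.symm
  have hw2 : w.2 = z.2 / deriv φ z.1 := congrArg Prod.snd hwz.symm
  have hPV : pushforward φ V w = N z := hMN.eq_of_nhds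
  have hPU : pushforward φ U w = fderiv ℝ (cotLift φ) z (U z) := rfl
  have hPW : pushforward φ (nabla (fun z => z.2 * ν z.1) U V) w
    = fderiv ℝ (cotLift φ) z (nabla (fun z => z.2 * ν z.1) U V z) := rfl
  rw [nabla, hfd, hPV, hPW, hPU, (hL z hzs.1).2, (hL z hzs.1).2, hN.fderiv, hw1, hw2]
  have hA0 := h0 _ hzs.1
  have hz2 : z.2 ≠ 0 := hzs.2.ne'
  ext
  · simp only [nabla, N, Pi.mul_apply]
    generalize deriv φ z.1 = A at *
    generalize deriv (deriv φ) z.1 = B at *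
    simp
    field_simp
    ring
  · simp only [nabla, N, Pi.mul_apply]
    generalize deriv φ z.1 = A at *
    generalize deriv (deriv φ) z.1 = B at *
    simp
    field_simp at key ⊢
    linear_combination (-(z.2 ^ 2 * (U z).1 * (V z).1)) * key

theorem projectiveGroupoid_isCompatible (ν : ℝ → ℝ) : IsCompatible ν (projectiveGroupoid ν) where
  restr := projectiveGroupoid_restr ν
  smooth _ hφ := (mem_projectiveGroupoid.1 hφ).smooth
  deriv_pos _ hφ := (mem_projectiveGroupoid.1 hφ).deriv_pos
  preserves _ hφ := (mem_projectiveGroupoid.1 hφ).preserves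

/-! ### Compatible diffeomorphisms with prescribed two-jets -/

/-- An integral curve of a smooth vector field is smooth. -/
theorem contDiffOn_of_hasDerivAt {E : Type*} [NormedAddCommGroup E] [NormedSpace ℝ E]
    {F : E → E} (hF : ContDiff ℝ ∞ F) {α : ℝ → E} {s : Set ℝ} (hs : IsOpen s)
    (hα : ∀ t ∈ s, HasDerivAt α (F (α t)) t) : ContDiffOn ℝ ∞ α s := by
  have hd : DifferentiableOn ℝ α s := fun t ht => (hα t ht).differentiableAt.differentiableWithinAt
  rw [contDiffOn_infty]
  intro n
  induction n with
  | zero => exact contDiffOn_zero.2 hd.continuousOn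
  | succ n ih =>
    rw [Nat.cast_succ]
    refine (contDiffOn_succ_iff_deriv_of_isOpen hs).2
      ⟨hd, fun h => absurd h (WithTop.coe_ne_top (a := (n : ℕ∞))), ?_⟩
    exact ((hF.of_le (by exact_mod_cast le_top)).comp_contDiffOn ih).congr
      fun t ht => (hα t ht).deriv

/-- The third order equation `S(φ) = (φ')² (ν ∘ φ) - ν` as a first order system for
`(t, φ, φ', φ'' / φ')`. -/
def projectiveField (ν : ℝ → ℝ) (a : ℝ × ℝ × ℝ × ℝ) : ℝ × ℝ × ℝ × ℝ :=
  (1, a.2.2.1, a.2.2.1 * a.2.2.2,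
    1 / 2 * a.2.2.2 ^ 2 + a.2.2.1 ^ 2 * ν a.2.1 - ν a.1)

theorem contDiff_projectiveField {ν : ℝ → ℝ} (hν : ContDiff ℝ ∞ ν) :
    ContDiff ℝ ∞ (projectiveField ν) := by
  unfold projectiveField
  fun_prop

/-- A solution, near `x`, of the equation `S(φ) = (φ')² (ν ∘ φ) - ν` with given two-jet at `x`. -/
theorem exists_projective_solution {ν : ℝ → ℝ} (hν : ContDiff ℝ ∞ ν) (x y c : ℝ) :
    ∃ (f : ℝ → ℝ) (u : Set ℝ), IsOpen u ∧ x ∈ u ∧ IsProjective ν f u ∧ f x = y ∧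
      deriv f x = 1 ∧ deriv (deriv f) x = c := by
  obtain ⟨r, hr, ε, hε, h⟩ :=
    ContDiffAt.exists_forall_mem_closedBall_exists_eq_forall_mem_Ioo_hasDerivAt
      (((contDiff_projectiveField hν).of_le (by exact_mod_cast le_top)).contDiffAt
        (x := ((x, y, 1, c) : ℝ × ℝ × ℝ × ℝ)) (n := 1)) x
  obtain ⟨α, hα0, hα⟩ := h _ (Metric.mem_closedBall_self hr.le)
  set I := Set.Ioo (x - ε) (x + ε) with hI
  have hIo : IsOpen I := isOpen_Ioo
  have hxI : x ∈ I := ⟨by linarith, by linarith⟩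
  have hs : ContDiffOn ℝ ∞ α I := contDiffOn_of_hasDerivAt (contDiff_projectiveField hν) hIo hα
  have d1 : ∀ t ∈ I, HasDerivAt (fun t => (α t).1) 1 t := fun t ht => (hα t ht).fst
  have d2 : ∀ t ∈ I, HasDerivAt (fun t => (α t).2.1) (α t).2.2.1 t := fun t ht =>
    (hα t ht).snd.fst
  have d3 : ∀ t ∈ I, HasDerivAt (fun t => (α t).2.2.1) ((α t).2.2.1 * (α t).2.2.2) t :=
    fun t ht => (hα t ht).snd.snd.fst
  have d4 : ∀ t ∈ I, HasDerivAt (fun t => (α t).2.2.2)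
      (1 / 2 * (α t).2.2.2 ^ 2 + (α t).2.2.1 ^ 2 * ν (α t).2.1 - ν (α t).1) t :=
    fun t ht => (hα t ht).snd.snd.snd
  have ht : ∀ t ∈ I, (α t).1 = t := by
    refine hIo.eqOn_of_deriv_eq (f := fun t => (α t).1) (g := fun t => t) isPreconnected_Ioo
      (fun t ht => (d1 t ht).differentiableAt.differentiableWithinAt)
      differentiableOn_id (fun t ht => ?_) hxI (by simp [hα0])
    rw [(d1 t ht).deriv, deriv_id'']
  have e1 : ∀ t ∈ I, deriv (fun t => (α t).2.1) t = (α t).2.2.1 := fun t ht => (d2 t ht).deriv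
  have e2 : ∀ t ∈ I, deriv (deriv fun t => (α t).2.1) t = (α t).2.2.1 * (α t).2.2.2 :=
    fun t ht => by
      have : deriv (fun t => (α t).2.1) =ᶠ[𝓝 t] fun t => (α t).2.2.1 :=
        Filter.eventually_of_mem (hIo.mem_nhds ht) e1
      rw [this.deriv_eq, (d3 t ht).deriv]
  let u := I ∩ (fun t => (α t).2.2.1) ⁻¹' Set.Ioi 0
  have hu : IsOpen u := ContinuousOn.isOpen_inter_preimage
    (fun t ht => (d3 t ht).continuousAt.continuousWithinAt) hIo isOpen_Ioi
  refine ⟨fun t => (α t).2.1, u, hu, ⟨hxI, by simp [hα0]⟩, ⟨?_, ?_, ?_⟩, by simp [hα0],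
    by rw [e1 x hxI, hα0], by rw [e2 x hxI, hα0, one_mul]⟩
  · exact (contDiff_fst.comp contDiff_snd).comp_contDiffOn (hs.mono Set.inter_subset_left)
  · intro t ht
    rw [e1 t ht.1]
    exact ht.2
  · intro t hu'
    have h3 : ∀ t ∈ u, preSchwarzian (fun t => (α t).2.1) t = (α t).2.2.2 := fun t ht => by
      rw [preSchwarzian, e1 t ht.1, e2 t ht.1]
      exact mul_div_cancel_left₀ _ (ne_of_gt ht.2)
    have h4 : preSchwarzian (fun t => (α t).2.1) =ᶠ[𝓝 t] fun t => (α t).2.2.2 :=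
      Filter.eventually_of_mem (hu.mem_nhds hu') h3
    rw [defect, h4.deriv_eq, (d4 t hu'.1).deriv, h3 t hu', e1 t hu'.1, ht t hu'.1]
    ring

/-- For every smooth `ν` there are elements of the pseudogroup with arbitrary value and arbitrary
second derivative at a point, and with first derivative `1` there. -/
theorem exists_mem_projectiveGroupoid {ν : ℝ → ℝ} (hν : ContDiff ℝ ∞ ν) (x y c : ℝ) :
    ∃ φ ∈ projectiveGroupoid ν, x ∈ φ.source ∧ φ x = y ∧ deriv φ x = 1 ∧
      deriv (deriv φ) x = c := by
  obtain ⟨f, u, hu, hx, hf, h0, h1, h2⟩ := exists_projective_solution hν x y c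
  have hd : HasDerivAt f 1 x := by rw [← h1]; exact hf.smooth.hasDerivAt_isOpen hu hx
  have hc : ContDiffAt ℝ ∞ f x := hf.smooth.contDiffAt (hu.mem_nhds hx)
  let e := ContDiffAt.toOpenPartialHomeomorph f hc (hd.hasFDerivAt_equiv one_ne_zero) (by simp)
  refine ⟨e.restrOpen u hu, mem_projectiveGroupoid.2 (hf.mono ?_), ⟨?_, hx⟩, h0, h1, h2⟩
  · rw [e.restrOpen_source]; exact Set.inter_subset_right
  · exact hc.mem_toOpenPartialHomeomorph_source _ (by simp)

/-! ### Functions with prescribed jets -/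

/-- There is a polynomial function with prescribed derivatives of order less than `K` at a
point. -/
theorem exists_polynomial_jet (x : ℝ) (K : ℕ) (t : ℕ → ℝ) :
    ∃ p : Polynomial ℝ, ∀ k < K, iteratedDeriv k (fun y => p.eval y) x = t k := by
  let q : Polynomial ℝ := ∑ k ∈ Finset.range K, Polynomial.monomial k (t k / k.factorial)
  refine ⟨Polynomial.taylor (-x) q, fun k hk => ?_⟩
  have h1 : ∀ p : Polynomial ℝ, iteratedDeriv k (fun y => p.eval y)
      = fun y => (Polynomial.derivative^[k] p).eval y := by
    intro p
    induction k with
    | zero => simp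
    | succ k ih =>
      rw [iteratedDeriv_succ, ih (by omega), Function.iterate_succ_apply']
      funext y
      exact Polynomial.deriv _
  rw [h1, ← Polynomial.factorial_smul_hasseDeriv]
  beta_reduce
  rw [LinearMap.smul_apply, Polynomial.eval_smul, nsmul_eq_mul, ← Polynomial.taylor_coeff,
    Polynomial.taylor_taylor, add_neg_cancel, Polynomial.taylor_zero]
  have hq : q.coeff k = t k / k.factorial := by
    simp only [q, Polynomial.finsetSum_coeff, Polynomial.coeff_monomial]
    simp [hk]
  rw [hq]
  field_simp

/-- There is a smooth function with prescribed derivatives of order less than `K` at the points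
`0, ..., N - 1`. -/
theorem exists_contDiff_jets (N K : ℕ) (t : Fin N → ℕ → ℝ) :
    ∃ ν : ℝ → ℝ, ContDiff ℝ ∞ ν ∧ ∀ i : Fin N, ∀ k < K, iteratedDeriv k ν i = t i k := by
  choose p hp using fun i : Fin N => exists_polynomial_jet (i : ℝ) K (t i)
  let b : ∀ i : Fin N, ContDiffBump ((i : ℕ) : ℝ) := fun i =>
    ⟨1 / 4, 1 / 2, by norm_num, by norm_num⟩
  refine ⟨fun y => ∑ i, b i y * (p i).eval y, ?_, fun i k hk => ?_⟩
  · exact ContDiff.sum fun i _ =>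
      (b i).contDiff.mul (by simpa using (p i).contDiff_aeval (𝕜 := ℝ) ∞)
  · have : (fun y => ∑ i, b i y * (p i).eval y) =ᶠ[𝓝 (i : ℝ)] fun y => (p i).eval y := by
      filter_upwards [(b i).eventuallyEq_one, Metric.ball_mem_nhds (i : ℝ) one_half_pos]
        with y h1 h2
      rw [Finset.sum_eq_single i, h1, Pi.one_apply, one_mul]
      · intro j _ hj
        rw [(b j).zero_of_le_dist, zero_mul]
        have h3 : (1 : ℝ) ≤ dist (j : ℝ) (i : ℝ) := by
          rw [Nat.dist_cast_real]
          exact Nat.pairwise_one_le_dist fun h => hj (Fin.ext h)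
        have h4 := dist_triangle (j : ℝ) y i
        rw [Metric.mem_ball] at h2
        rw [dist_comm (j : ℝ) y] at h4
        change 1 / 2 ≤ _
        linarith
      · exact fun h => absurd (Finset.mem_univ i) h
    rw [this.iteratedDeriv_eq, hp i k hk]

/-! ### Evaluation of the action on test functions -/

theorem rho_apply (ν : ℝ → ℝ) (p : P) (z : ℝ × ℝ) :
    rho ν p z = MvPolynomial.eval (fun k => opX^[k] (Omega ν) z) p := by
  have : (Pi.evalAlgHom ℂ (fun _ : ℝ × ℝ => ℂ) z).comp (rho ν)
      = MvPolynomial.aeval fun k => opX^[k] (Omega ν) z :=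
    MvPolynomial.algHom_ext fun k => by simp [rho_X]
  exact congrArg (fun f => f p) this

theorem opX_iterate_Omega {ν : ℝ → ℝ} (hν : ContDiff ℝ ∞ ν) (k : ℕ) :
    opX^[k] (Omega ν) = fun z => ((-(z.2 ^ (k + 2) * iteratedDeriv k ν z.1) : ℝ) : ℂ) := by
  induction k with
  | zero => funext z; simp [Omega]
  | succ k ih =>
    rw [Function.iterate_succ_apply', ih]
    funext z
    have hd : HasDerivAt (iteratedDeriv k ν) (iteratedDeriv (k + 1) ν z.1) z.1 := by
      rw [iteratedDeriv_succ]
      exact (hν.differentiable_iteratedDeriv k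
        (WithTop.coe_lt_coe.2 (WithTop.coe_lt_top k)) _).hasDerivAt
    have h1 : HasFDerivAt (fun z : ℝ × ℝ => iteratedDeriv k ν z.1) _ z :=
      hd.hasFDerivAt.comp z (hasFDerivAt_fst (𝕜 := ℝ) (p := z))
    have h2 := (((hasFDerivAt_snd (𝕜 := ℝ) (p := z)).pow (k + 2)).mul h1).neg
    have h3 : HasFDerivAt
        (fun z : ℝ × ℝ => ((-(z.2 ^ (k + 2) * iteratedDeriv k ν z.1) : ℝ) : ℂ)) _ z :=
      Complex.ofRealCLM.hasFDerivAt.comp z h2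
    rw [opX, h3.fderiv]
    simp
    ring

theorem opX_iterate_congr {F G : ℝ × ℝ → ℂ} {z : ℝ × ℝ} (h : F =ᶠ[𝓝 z] G) (a : ℕ) :
    opX^[a] F =ᶠ[𝓝 z] opX^[a] G := by
  induction a with
  | zero => exact h
  | succ a ih =>
    filter_upwards [ih.eventually_nhds] with w hw
    rw [Function.iterate_succ_apply', Function.iterate_succ_apply', opX_congr hw]

theorem opY_iterate_congr {F G : ℝ × ℝ → ℂ} {z : ℝ × ℝ} (h : F =ᶠ[𝓝 z] G) (a : ℕ) :
    opY^[a] F =ᶠ[𝓝 z] opY^[a] G := by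
  induction a with
  | zero => exact h
  | succ a ih =>
    filter_upwards [ih.eventually_nhds] with w hw
    rw [Function.iterate_succ_apply', Function.iterate_succ_apply', opY_congr hw]

/-- The function `exp (s (x - x₀)) y ^ m`. -/
def expFn (s x₀ : ℝ) (m : ℕ) (z : ℝ × ℝ) : ℂ := ((Real.exp (s * (z.1 - x₀)) * z.2 ^ m : ℝ) : ℂ)

theorem contDiff_expFn (s x₀ : ℝ) (m : ℕ) : ContDiff ℝ ∞ (expFn s x₀ m) := by
  refine Complex.ofRealCLM.contDiff.comp (ContDiff.mul ?_ ?_) <;> fun_prop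

theorem opX_opY_expFn (s x₀ : ℝ) (m : ℕ) (z : ℝ × ℝ) :
    opX (expFn s x₀ m) z = s * expFn s x₀ (m + 1) z ∧
      opY (expFn s x₀ m) z = m * expFn s x₀ m z := by
  have h1 : HasDerivAt (fun t : ℝ => Real.exp (s * (t - x₀)))
      (Real.exp (s * (z.1 - x₀)) * (s * 1)) z.1 :=
    (((hasDerivAt_id z.1).sub_const x₀).const_mul s).exp
  have h2 : HasFDerivAt (fun z : ℝ × ℝ => Real.exp (s * (z.1 - x₀))) _ z :=
    h1.hasFDerivAt.comp z (hasFDerivAt_fst (𝕜 := ℝ) (p := z))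
  have h3 : HasFDerivAt (expFn s x₀ m) _ z :=
    Complex.ofRealCLM.hasFDerivAt.comp z
      (h2.mul ((hasFDerivAt_snd (𝕜 := ℝ) (p := z)).pow m))
  rw [opX, opY, h3.fderiv]
  constructor
  · simp [expFn]
    ring
  · cases m with
    | zero => simp [expFn]
    | succ m =>
      simp [expFn]
      ring

theorem opX_iterate_opY_iterate_expFn (s x₀ : ℝ) (m a b : ℕ) :
    opX^[a] (opY^[b] (expFn s x₀ m)) = fun z => (m : ℂ) ^ b * s ^ a * expFn s x₀ (m + a) z := by
  induction a with
  | zero =>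
    induction b with
    | zero => funext z; simp
    | succ b ih =>
      rw [Function.iterate_zero, id] at ih ⊢
      rw [Function.iterate_succ_apply', ih]
      funext z
      rw [opY_const_mul _ ((contDiff_expFn s x₀ (m + 0)).differentiable (by simp) z),
        (opX_opY_expFn s x₀ _ z).2]
      push_cast
      ring
  | succ a ih =>
    rw [Function.iterate_succ_apply', ih]
    funext z
    rw [opX_const_mul _ ((contDiff_expFn s x₀ (m + a)).differentiable (by simp) z),
      (opX_opY_expFn s x₀ _ z).1, add_assoc]
    ring

section

variable {D : Datum}

/-- Over each point of the source of `φ` at height `1` there is a monomial `f U_{φ⁻¹}` such that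
`X ^ a Y ^ b f` takes the value `s ^ a m ^ b` there, for all `a` and `b`. -/
theorem exists_mono {φ : OpenPartialHomeomorph ℝ ℝ} (hφ : φ ∈ D.Γ) {x : ℝ} (hx : x ∈ φ.source)
    (s m : ℕ) : ∃ f : Mono D, f.φ = φ ∧
      ∀ a b, opX^[a] (opY^[b] f.f) (x, 1) = (s : ℂ) ^ a * (m : ℂ) ^ b := by
  obtain ⟨ε, hε, hb⟩ := Metric.nhds_basis_closedBall.mem_iff.1
    ((isOpen_slab φ).mem_nhds (show ((x, 1) : ℝ × ℝ) ∈ slab φ from ⟨hx, one_pos⟩))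
  let χ : ContDiffBump ((x, 1) : ℝ × ℝ) := ⟨ε / 2, ε, by positivity, by linarith⟩
  let F : ℝ × ℝ → ℂ := fun z => ((χ z : ℝ) : ℂ) * expFn s x m z
  have hts : tsupport F ⊆ tsupport χ := closure_mono fun z hz h => hz (by simp [F, h])
  have hχ : tsupport χ ⊆ slab φ := by rw [χ.tsupport_eq]; exact hb
  refine ⟨⟨φ, F, hφ, (Complex.ofRealCLM.contDiff.comp χ.contDiff).mul (contDiff_expFn _ _ _),
    χ.hasCompactSupport.of_isClosed_subset (isClosed_tsupport _) hts, hts.trans hχ⟩, rfl,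
    fun a b => ?_⟩
  have hF : F =ᶠ[𝓝 (x, 1)] expFn s x m := by
    filter_upwards [χ.eventuallyEq_one] with z hz
    simp [F, hz]
  rw [(opX_iterate_congr (opY_iterate_congr hF b) a).eq_of_nhds, opX_iterate_opY_iterate_expFn]
  simp [expFn, mul_comm]

/-- The linear functional `f U_{φ⁻¹} ↦ f z` on the groupoid algebra: the sum of the values at all
germs over the point `z`. -/
def evalAt (D : Datum) (z : ℝ × ℝ) : A D →ₗ[ℂ] ℂ :=
  A.lift (fun m => m.f z) (fun m₁ m₂ m _ _ hf => by rw [hf, Pi.add_apply])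
    (fun c m₁ m _ hf => by rw [hf, Pi.smul_apply]) (fun m₁ m hf _ => by rw [hf])

theorem evalAt_mk (z : ℝ × ℝ) (m : Mono D) : evalAt D z (A.mk m) = m.f z := A.lift_mk _ _ _ _ m

theorem A.X_pow_mk (a : ℕ) (m : Mono D) : ∃ m' : Mono D, (A.X D ^ a) (A.mk m) = A.mk m' ∧
    m'.φ = m.φ ∧ m'.f = opX^[a] m.f := by
  induction a with
  | zero => exact ⟨m, rfl, rfl, rfl⟩
  | succ a ih =>
    obtain ⟨m', h, hφ, hf⟩ := ih
    refine ⟨m'.X, ?_, hφ, ?_⟩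
    · rw [pow_succ', Module.End.mul_apply, h, A.X_mk]
    · rw [Function.iterate_succ_apply', ← hf]; rfl

theorem A.Y_pow_mk (a : ℕ) (m : Mono D) : ∃ m' : Mono D, (A.Y D ^ a) (A.mk m) = A.mk m' ∧
    m'.φ = m.φ ∧ m'.f = opY^[a] m.f := by
  induction a with
  | zero => exact ⟨m, rfl, rfl, rfl⟩
  | succ a ih =>
    obtain ⟨m', h, hφ, hf⟩ := ih
    refine ⟨m'.Y, ?_, hφ, ?_⟩
    · rw [pow_succ', Module.End.mul_apply, h, A.Y_mk]
    · rw [Function.iterate_succ_apply', ← hf]; rfl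

theorem A.multiply_pow_mk (M : Multiplier D) (k : ℕ) (m : Mono D) :
    ∃ m' : Mono D, (A.multiply M ^ k) (A.mk m) = A.mk m' ∧
      m'.φ = m.φ ∧ ∀ z, m'.f z = m.f z * M.G m.φ z ^ k := by
  induction k with
  | zero => exact ⟨m, rfl, rfl, fun z => by simp⟩
  | succ k ih =>
    obtain ⟨m', h, hφ, hf⟩ := ih
    refine ⟨m'.multiply M, ?_, hφ, fun z => ?_⟩
    · rw [pow_succ', Module.End.mul_apply, h, A.multiply_mk]
    · change m'.f z * M.G m'.φ z = _
      rw [hf, hφ, pow_succ, mul_assoc]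

/-- The action of an ordered monomial. -/
theorem chiOne_ordered (μ μ' : ℕ →₀ ℕ) (e : Fin 3 → ℕ) (m : Mono D) :
    ∃ m' : Mono D, chiOne D (Hs.ordered μ μ' e) (A.mk m) = A.mk m' ∧ m'.φ = m.φ ∧
      ∀ z, m'.f z = opX^[e 1] (opY^[e 2] m.f) z * muFn m.φ z ^ e 0
        * rho D.ν (monomial μ' 1) (frameLift m.φ z) * rho D.ν (monomial μ 1) z := by
  obtain ⟨m₁, h₁, hφ₁, hf₁⟩ := A.Y_pow_mk (e 2) m
  obtain ⟨m₂, h₂, hφ₂, hf₂⟩ := A.X_pow_mk (e 1) m₁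
  obtain ⟨m₃, h₃, hφ₃, hf₃⟩ := A.multiply_pow_mk (A.deltaMultiplier D 0) (e 0) m₂
  refine ⟨(m₃.multiply (A.rightMultiplier D (monomial μ' 1))).multiply
    (A.leftMultiplier D (monomial μ 1)), ?_, (hφ₃.trans hφ₂).trans hφ₁, fun z => ?_⟩
  · simp only [Hs.ordered, Hs.word, map_mul, map_pow, chiOne_gen, genAction, Module.End.mul_apply,
      h₁, h₂, A.delta, h₃, A.left, A.right, A.multiply_mk]
  · change m₃.f z * rho D.ν (monomial μ' 1) (frameLift m₃.φ z) * rho D.ν (monomial μ 1) z = _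
    rw [hf₃, hf₂, hf₁, hφ₃, hφ₂, hφ₁]
    rfl

/-- The product of a tuple of monomials. -/
def Mono.prod : (n : ℕ) → (Fin (n + 1) → Mono D) → Mono D
  | 0, m => m 0
  | n + 1, m => m 0 * Mono.prod n (Fin.tail m)

theorem mulAll_mk (n : ℕ) (m : Fin (n + 1) → Mono D) :
    mulAll D n (fun i => A.mk (m i)) = A.mk (Mono.prod n m) := by
  induction n with
  | zero => rfl
  | succ n ih =>
    rw [mulAll_succ, Mono.prod, ← A.mk_mul_mk, ← ih]
    rfl

/-- The value of a product of monomials is the product of the values along the orbit. -/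
theorem Mono.prod_f (n : ℕ) (m : Fin (n + 1) → Mono D) (z : Fin (n + 2) → ℝ × ℝ)
    (hz : ∀ i : Fin (n + 1), frameLift (m i).φ (z i.castSucc) = z i.succ) :
    (Mono.prod n m).f (z 0) = ∏ i, (m i).f (z i.castSucc) := by
  induction n with
  | zero => simp [Mono.prod]
  | succ n ih =>
    have h := ih (Fin.tail m) (Fin.tail z) fun i => hz i.succ
    have h0 := hz 0
    rw [Fin.castSucc_zero] at h0
    rw [Mono.prod, Mono.mul_f, h0, Fin.prod_univ_succ, Fin.castSucc_zero]
    exact congrArg _ h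

theorem chi_basicTensor {n : ℕ} (j : Exponents n) (a : Fin (n + 1) → A D) :
    chi D n (basicTensor j) a
      = mulAll D n fun i => chiOne D (Hs.ordered (j.1 i.castSucc) (j.right i) (j.2 i)) (a i) :=
  chiTensor_tprod D n _ a

end

/-- For arbitrary parameters `t`, `c`, `s`, `m` there are a compatible pseudogroup and elements of
its groupoid algebra on which the ordered monomials act, up to evaluation at a point, by the
corresponding monomials in the parameters. -/
theorem exists_evaluation (n K : ℕ) (t : Fin (n + 2) → ℕ → ℕ) (c s m : Fin (n + 1) → ℕ) :
    ∃ (ν : ℝ → ℝ) (hν : ContDiff ℝ ∞ ν) (Γ : StructureGroupoid ℝ) (hΓ : IsCompatible ν Γ)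
      (a : Fin (n + 1) → A ⟨ν, hν, Γ, hΓ⟩) (z : ℝ × ℝ),
      ∀ j : Exponents n, (∀ i, ∀ k ∈ (j.1 i).support, k < K) →
        evalAt _ z (chi _ n (basicTensor j) a)
          = (∏ i, MvPolynomial.eval (fun k => (t i k : ℂ)) (monomial (j.1 i) 1))
            * ∏ i, (c i : ℂ) ^ j.2 i 0 * (s i : ℂ) ^ j.2 i 1 * (m i : ℂ) ^ j.2 i 2 := by
  -- The points of the orbit are `(i, 1)`; the sign is that of `Ω = -y² ν`.
  obtain ⟨ν, hν, hjet⟩ := exists_contDiff_jets (n + 2) K fun i k => -(t i k : ℝ)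
  choose φ hφ hs h0 h1 h2 using fun i : Fin (n + 1) =>
    exists_mem_projectiveGroupoid hν (i.castSucc : ℕ) (i.succ : ℕ) (c i)
  let D : Datum := ⟨ν, hν, projectiveGroupoid ν, projectiveGroupoid_isCompatible ν⟩
  choose f hfφ hf using fun i : Fin (n + 1) => exists_mono (D := D) (hφ i) (hs i) (s i) (m i)
  let z : Fin (n + 2) → ℝ × ℝ := fun i => ((i : ℕ), 1)
  have hz : ∀ i : Fin (n + 1), frameLift (φ i) (z i.castSucc) = z i.succ := fun i => by
    simp only [frameLift, z, h0, h1, mul_one]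
  refine ⟨ν, hν, projectiveGroupoid ν, projectiveGroupoid_isCompatible ν,
    fun i => A.mk (f i), z 0, fun j hj => ?_⟩
  have hrho : ∀ i, rho ν (monomial (j.1 i) 1) (z i)
      = MvPolynomial.eval (fun k => (t i k : ℂ)) (monomial (j.1 i) 1) := fun i => by
    rw [rho_apply, MvPolynomial.eval_monomial, MvPolynomial.eval_monomial]
    refine congrArg _ (Finsupp.prod_congr fun k hk => ?_)
    rw [opX_iterate_Omega hν]
    simp only [z, one_pow, one_mul, hjet i k (hj i k hk)]
    simp
  choose g hg hgφ hgf using fun i : Fin (n + 1) =>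
    chiOne_ordered (D := D) (j.1 i.castSucc) (j.right i) (j.2 i) (f i)
  have hpath : ∀ i : Fin (n + 1), frameLift (g i).φ (z i.castSucc) = z i.succ := fun i => by
    rw [hgφ, hfφ]; exact hz i
  have hfac : ∀ i, (g i).f (z i.castSucc)
      = (c i : ℂ) ^ j.2 i 0 * (s i : ℂ) ^ j.2 i 1 * (m i : ℂ) ^ j.2 i 2
        * rho ν (monomial (j.right i) 1) (z i.succ)
        * MvPolynomial.eval (fun k => (t i.castSucc k : ℂ)) (monomial (j.1 i.castSucc) 1) :=
    fun i => by
      have hmu : muFn (φ i) (z i.castSucc) = c i := by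
        simp only [muFn, z, h1, h2, div_one, one_mul, Complex.ofReal_natCast]
      rw [hgf, hfφ, hz, hmu]
      change opX^[j.2 i 1] (opY^[j.2 i 2] (f i).f) ((i.castSucc : ℕ), 1) * _ * rho ν _ _
        * rho ν _ _ = _
      rw [hf, hrho]
      ring
  have hright : ∏ i, rho ν (monomial (j.right i) 1) (z i.succ)
      = MvPolynomial.eval (fun k => (t (Fin.last (n + 1)) k : ℂ))
          (monomial (j.1 (Fin.last (n + 1))) 1) := by
    rw [Fin.prod_univ_castSucc, Finset.prod_eq_one, one_mul]
    · rw [Exponents.right, if_pos rfl, Fin.succ_last, hrho]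
    · intro i _
      rw [Exponents.right, if_neg (Fin.castSucc_lt_last i).ne, monomial_zero_one, map_one]
      rfl
  rw [chi_basicTensor]
  simp only [D] at hg
  simp only [hg]
  rw [mulAll_mk, evalAt_mk, Mono.prod_f n g z hpath, Finset.prod_congr rfl fun i _ => hfac i,
    Finset.prod_mul_distrib, Finset.prod_mul_distrib, hright, Fin.prod_univ_castSucc (n := n + 1)]
  ring

/-! ### Independence of the evaluations -/

/-- The parameters of the evaluations: jets of `ν` at `n + 2` points, and for each of the `n + 1`
steps of the orbit the second derivative of `φ` and the eigenvalues of `X` and `Y`. -/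
abbrev Params (n : ℕ) : Type := (Fin (n + 2) × ℕ) ⊕ (Fin (n + 1) × Fin 3)

/-- The exponents of an ordered monomial as exponents of the parameters. -/
def Exponents.toFinsupp {n : ℕ} (j : Exponents n) : Params n →₀ ℕ :=
  ∑ i, (j.1 i).mapDomain (fun k => Sum.inl (i, k))
    + ∑ i, ∑ l, Finsupp.single (Sum.inr (i, l)) (j.2 i l)

theorem Exponents.toFinsupp_injective (n : ℕ) :
    Function.Injective (Exponents.toFinsupp (n := n)) := by
  have hinj : ∀ i : Fin (n + 2), Function.Injective fun k : ℕ => (Sum.inl (i, k) : Params n) :=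
    fun i k k' h => by simpa using h
  have e1 : ∀ (j : Exponents n) i k, j.toFinsupp (Sum.inl (i, k)) = j.1 i k := by
    intro j i k
    rw [toFinsupp, Finsupp.add_apply, Finsupp.finsetSum_apply, Finsupp.finsetSum_apply,
      Finset.sum_eq_single i, Finset.sum_eq_zero, add_zero]
    · exact Finsupp.mapDomain_apply (hinj i) _ _
    · intro i' _
      simp [Finsupp.finsetSum_apply]
    · intro i' _ hi
      refine Finsupp.mapDomain_of_notMem_range _ _ ?_
      rintro ⟨k', h⟩
      simp [hi] at h
    · simp
  have e2 : ∀ (j : Exponents n) i l, j.toFinsupp (Sum.inr (i, l)) = j.2 i l := by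
    intro j i l
    rw [toFinsupp, Finsupp.add_apply, Finsupp.finsetSum_apply, Finsupp.finsetSum_apply,
      Finset.sum_eq_zero, zero_add, Finset.sum_eq_single i, Finsupp.finsetSum_apply,
      Finset.sum_eq_single l]
    · simp
    · intro l' _ hl
      simp [hl]
    · simp
    · intro i' _ hi
      simp [Finsupp.finsetSum_apply, hi]
    · simp
    · intro i' _
      refine Finsupp.mapDomain_of_notMem_range _ _ ?_
      rintro ⟨k', h⟩
      simp at h
  intro j j' h
  refine Prod.ext ?_ ?_
  · funext i
    ext k
    rw [← e1, ← e1, h]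
  · funext i l
    rw [← e2, ← e2, h]

theorem eval_toFinsupp {n : ℕ} (v : Params n → ℂ) (j : Exponents n) :
    MvPolynomial.eval v (monomial j.toFinsupp 1)
      = (∏ i, MvPolynomial.eval (fun k => v (.inl (i, k))) (monomial (j.1 i) 1))
        * ∏ i, v (.inr (i, 0)) ^ j.2 i 0 * v (.inr (i, 1)) ^ j.2 i 1
          * v (.inr (i, 2)) ^ j.2 i 2 := by
  have h : (monomial j.toFinsupp (1 : ℂ))
      = (∏ i, MvPolynomial.rename (fun k => Sum.inl (i, k)) (monomial (j.1 i) (1 : ℂ)))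
        * ∏ i, ∏ l, MvPolynomial.X (Sum.inr (i, l)) ^ j.2 i l := by
    simp only [Exponents.toFinsupp, MvPolynomial.rename_monomial, MvPolynomial.X_pow_eq_monomial,
      ← MvPolynomial.monomial_sum_one, MvPolynomial.monomial_mul, mul_one]
  rw [h, map_mul, map_prod, map_prod]
  simp only [MvPolynomial.eval_rename, map_mul, map_pow, MvPolynomial.eval_X, Fin.prod_univ_three]
  rfl

/-- A combination of ordered monomials that is killed by all actions is trivial. -/
theorem eq_zero_of_forall_chi {n : ℕ} (C : Exponents n →₀ ℂ)
    (h : ∀ (ν : ℝ → ℝ) (hν : ContDiff ℝ ∞ ν) (Γ : StructureGroupoid ℝ) (hΓ : IsCompatible ν Γ),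
      chi ⟨ν, hν, Γ, hΓ⟩ n (C.sum fun j r => r • basicTensor j) = 0) : C = 0 := by
  let Q : MvPolynomial (Params n) ℂ := C.sum fun j r => r • monomial j.toFinsupp 1
  have hQ : Q = 0 := by
    refine MvPolynomial.funext_set (fun _ => Set.range fun k : ℕ => (k : ℂ))
      (fun _ => Set.infinite_range_of_injective Nat.cast_injective) fun v hv => ?_
    choose w hw using fun i => hv i (Set.mem_univ i)
    -- Only the derivatives of `ν` of order less than `K` occur.
    have hK : ∃ K, ∀ j ∈ C.support, ∀ i, ∀ k ∈ (j.1 i).support, k < K := by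
      refine ⟨(C.support.sup fun j => Finset.univ.sup fun i => (j.1 i).support.sup id) + 1,
        fun j hj i k hk => Nat.lt_succ_of_le ?_⟩
      exact (Finset.le_sup (f := id) hk).trans
        ((Finset.le_sup (f := fun i => (j.1 i).support.sup id) (Finset.mem_univ i)).trans
          (Finset.le_sup (f := fun j : Exponents n =>
            Finset.univ.sup fun i => (j.1 i).support.sup id) hj))
    obtain ⟨K, hK⟩ := hK
    obtain ⟨ν, hν, Γ, hΓ, a, z, hj⟩ := exists_evaluation n K (fun i k => w (.inl (i, k)))
      (fun i => w (.inr (i, 0))) (fun i => w (.inr (i, 1))) (fun i => w (.inr (i, 2)))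
    have h0 := congrArg (fun T => evalAt _ z (T a)) (h ν hν Γ hΓ)
    simp only [Finsupp.sum, map_sum, map_smul, sum_apply, smul_apply,
      zero_apply, map_zero] at h0
    rw [map_zero, ← h0]
    simp only [Q, Finsupp.sum, map_sum]
    refine Finset.sum_congr rfl fun j hjs => ?_
    rw [hj j (hK j hjs), MvPolynomial.smul_eval, eval_toFinsupp, smul_eq_mul]
    simp only [← hw]
  have hli : LinearIndependent ℂ
      fun j : Exponents n => (monomial j.toFinsupp (1 : ℂ) : MvPolynomial (Params n) ℂ) := by
    have := (MvPolynomial.basisMonomials (Params n) ℂ).linearIndependent.comp _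
      (Exponents.toFinsupp_injective n)
    rwa [MvPolynomial.coe_basisMonomials] at this
  exact (linearIndependent_iff.1 hli) C hQ

end FoliationHopf
end

/-- For every number `n + 1 ≥ 1` of factors, the common kernel of the actions, over all smooth `ν`
and all compatible pseudogroups `Γ`, is zero. -/
theorem proposition5p2 (n : ℕ) :
    (⨅ (ν : ℝ → ℝ) (hν : ContDiff ℝ ∞ ν) (Γ : StructureGroupoid ℝ)
      (hΓ : FoliationHopf.IsCompatible ν Γ),
      LinearMap.ker (FoliationHopf.chi ⟨ν, hν, Γ, hΓ⟩ n)) = ⊥ := by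
  rw [eq_bot_iff]
  intro T hT
  simp only [Submodule.mem_iInf, LinearMap.mem_ker] at hT
  have hspan : T ∈ Submodule.span ℂ (Set.range (FoliationHopf.basicTensor (n := n))) := by
    rw [FoliationHopf.basicTensor_span_eq_top]
    exact Submodule.mem_top
  obtain ⟨C, rfl⟩ := Finsupp.mem_span_range_iff_exists_finsupp.1 hspan
  rw [FoliationHopf.eq_zero_of_forall_chi C hT]
  simp
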